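/- Let $M$ be a smooth (second countable, Hausdorff, finite-dimensional) manifold of positive dimension, let $G$ be a Lie group whose Lie algebra $\mathfrak g$ is semisimple (i.e. has zero radical), and let $\pi:P\to M$ be a smooth principal $G$-bundle. Let $\mathcal A=\Gamma(TP/G)=\mathfrak X_G(P)$ be the Lie algebra of sections of the Atiyah algebroid of $P$, that is, of $G$-invariant smooth vector fields on $P$, let $\pi_*:\mathcal A\to\mathfrak X(M)$ be the anchor, and let $\mathcal K=\ker\pi_*$, a Lie ideal of $\mathcal A$. For $m\in M$ put $\mathcal A_m=\{a\in\mathcal A:(\pi_*a)_m=0\}$ and $\mathcal K(m)=\{k\in\mathcal K:k_m=0\}$. A maximal finite-codimensional Lie subalgebra (Lie ideal) is a proper Lie subalgebra (Lie ideal) of finite codimension that is not strictly contained in another proper one of finite codimension. A Lie ideal $\mathcal K_0$ of $\mathcal K$ is normalized by a Lie subalgebra $\mathcal T$ of $\mathcal A$ if $[\mathcal T,\mathcal K_0]\subset\mathcal K_0$, i.e. if $\mathcal T$ lies in the normalizer $N(\mathcal A,\mathcal K_0)=\{a\in\mathcal A:[a,\mathcal K_0]\subset\mathcal K_0\}$.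 Then each $\mathcal A_m$, $m\in M$, is a maximal finite-codimensional Lie subalgebra of $\mathcal A$. Conversely, for every maximal finite-codimensional Lie subalgebra $\mathcal T$ of $\mathcal A$ there is a unique $m\in M$ with $\mathcal T=\mathcal A_m$, and for this $m$ the intersection of all maximal finite-codimensional Lie ideals of $\mathcal K$ that are normalized by $\mathcal T$ is exactly $\mathcal K(m)$ (the intersection of the empty family being $\mathcal K$). Moreover, the normalizer in $\mathcal A$ of each of these ideals is exactly $\mathcal T=\mathcal A_m$. -/

import Mathlib

open scoped Manifold ContDiff Topology

noncomputable section AtiyahDefinitions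

open Set Filter VectorField

theorem completeSpace_of_finiteDimensional_real (E : Type*) [NormedAddCommGroup E] [NormedSpace ℝ E]
    [FiniteDimensional ℝ E] : CompleteSpace E := FiniteDimensional.complete ℝ E

attribute [instance] completeSpace_of_finiteDimensional_real

instance leInfty_minSmoothness_two : ENat.LEInfty (minSmoothness ℝ 2) := by
  rw [minSmoothness_of_isRCLikeNormedField]; infer_instance

instance leInfty_minSmoothness_three : ENat.LEInfty (minSmoothness ℝ 3) := by
  rw [minSmoothness_of_isRCLikeNormedField]; infer_instance

/-- The space `𝔛(M)` of smooth vector fields on a smooth manifold `M` without boundary, modelled on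
`E`. -/
abbrev SmoothVectorField (E : Type*) [NormedAddCommGroup E] [NormedSpace ℝ E]
    (M : Type*) [TopologicalSpace M] [ChartedSpace E M] [IsManifold 𝓘(ℝ, E) ∞ M] :=
  ContMDiffSection 𝓘(ℝ, E) E ∞ (TangentSpace 𝓘(ℝ, E) : M → Type _)

namespace SmoothVectorField

section LieAlgebra

variable {E : Type*} [NormedAddCommGroup E] [NormedSpace ℝ E] [FiniteDimensional ℝ E]
  {M : Type*} [TopologicalSpace M] [ChartedSpace E M] [IsManifold 𝓘(ℝ, E) ∞ M]

/-- The Lie bracket of vector fields. -/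
instance : Bracket (SmoothVectorField E M) (SmoothVectorField E M) where
  bracket X Y := ⟨mlieBracket 𝓘(ℝ, E) X Y, by
    have : IsManifold 𝓘(ℝ, E) (((⊤ : ℕ∞) : ℕ∞ω) + 1) M := by
      rw [show (((⊤ : ℕ∞) : ℕ∞ω) + 1) = ∞ from rfl]; infer_instance
    exact ContDiff.mlieBracket_vectorField (n := ⊤) (m := ⊤) X.contMDiff Y.contMDiff
      (by rw [minSmoothness_of_isRCLikeNormedField]; rfl)⟩

theorem lie_apply (X Y : SmoothVectorField E M) (x : M) :
    ⁅X, Y⁆ x = mlieBracket 𝓘(ℝ, E) X Y x := rfl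

instance : LieRing (SmoothVectorField E M) where
  add_lie X Y Z := by
    ext x
    exact mlieBracket_add_left X.mdifferentiableAt Y.mdifferentiableAt
  lie_add X Y Z := by
    ext x
    exact mlieBracket_add_right Y.mdifferentiableAt Z.mdifferentiableAt
  lie_self X := by
    ext x
    simp [lie_apply]
  leibniz_lie X Y Z := by
    ext x
    exact leibniz_identity_mlieBracket_apply
      (X.contMDiff.of_le ENat.LEInfty.out x) (Y.contMDiff.of_le ENat.LEInfty.out x)
      (Z.contMDiff.of_le ENat.LEInfty.out x)

instance : LieAlgebra ℝ (SmoothVectorField E M) where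
  lie_smul c X Y := by
    ext x
    exact mlieBracket_const_smul_right Y.mdifferentiableAt

end LieAlgebra
end SmoothVectorField

/-- Lie brackets of related vector fields are related, in vector spaces. -/
theorem lieBracket_related {E E' : Type*} [NormedAddCommGroup E] [NormedSpace ℝ E]
   [NormedAddCommGroup E'] [NormedSpace ℝ E'] {F : E → E'} {X Y : E → E} {v w : E' → E'} {x : E}
   (hF : ContDiffAt ℝ 2 F x) (hX : DifferentiableAt ℝ X x) (hY : DifferentiableAt ℝ Y x)
   (hv : DifferentiableAt ℝ v (F x)) (hw : DifferentiableAt ℝ w (F x))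
   (hXv : ∀ᶠ y in 𝓝 x, fderiv ℝ F y (X y) = v (F y))
   (hYw : ∀ᶠ y in 𝓝 x, fderiv ℝ F y (Y y) = w (F y)) :
   fderiv ℝ F x (lieBracket ℝ X Y x) = lieBracket ℝ v w (F x) := by
  have hF1 : DifferentiableAt ℝ F x := hF.differentiableAt (by simp)
  have hdF : DifferentiableAt ℝ (fderiv ℝ F) x :=
    (hF.fderiv_right (m := 1) (by norm_num)).differentiableAt (by simp)
  have key : ∀ {Z : E → E} {z : E' → E'}, DifferentiableAt ℝ Z x → DifferentiableAt ℝ z (F x) →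
      (∀ᶠ y in 𝓝 x, fderiv ℝ F y (Z y) = z (F y)) → ∀ a : E,
      fderiv ℝ (fderiv ℝ F) x a (Z x) + fderiv ℝ F x (fderiv ℝ Z x a)
        = fderiv ℝ z (F x) (fderiv ℝ F x a) := by
    intro Z z hZ hz h a
    have h1 := (hdF.hasFDerivAt.clm_apply hZ.hasFDerivAt).congr_of_eventuallyEq
      (h.mono fun y hy => hy.symm)
    have h2 := hz.hasFDerivAt.comp x hF1.hasFDerivAt
    have := congrArg (fun L => L a) (h1.unique h2)
    simpa [add_comm] using this
  have hs := hF.isSymmSndFDerivAt (by simp)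
  have e1 := key hX hv hXv (Y x)
  have e2 := key hY hw hYw (X x)
  rw [hYw.self_of_nhds] at e1
  rw [hXv.self_of_nhds] at e2
  rw [lieBracket, lieBracket, map_sub, ← e1, ← e2, hs (X x) (Y x)]
  abel

section Related

variable {E : Type*} [NormedAddCommGroup E] [NormedSpace ℝ E] [FiniteDimensional ℝ E]
  {M : Type*} [TopologicalSpace M] [ChartedSpace E M] [IsManifold 𝓘(ℝ, E) ∞ M]
  {E' : Type*} [NormedAddCommGroup E'] [NormedSpace ℝ E'] [FiniteDimensional ℝ E']
  {M' : Type*} [TopologicalSpace M'] [ChartedSpace E' M'] [IsManifold 𝓘(ℝ, E') ∞ M']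

/-- `X` and `v` are `f`-related: `T_x f (X_x) = v_{f(x)}` for all `x`. -/
def SmoothVectorField.Related (f : M → M') (X : SmoothVectorField E M)
    (v : SmoothVectorField E' M') : Prop :=
  ∀ x : M, mfderiv 𝓘(ℝ, E) 𝓘(ℝ, E') f x (X x) = v (f x)

/-- The local representative of a vector field in the preferred chart at `x₀`. -/
def SmoothVectorField.localRep (X : SmoothVectorField E M) (x₀ : M) (y : E) : E :=
  mpullbackWithin 𝓘(ℝ, E) 𝓘(ℝ, E) (extChartAt 𝓘(ℝ, E) x₀).symm X (range 𝓘(ℝ, E)) y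

theorem SmoothVectorField.localRep_chart (X : SmoothVectorField E M) (x₀ q : M)
    (hq : q ∈ (extChartAt 𝓘(ℝ, E) x₀).source) :
    X.localRep x₀ (extChartAt 𝓘(ℝ, E) x₀ q)
      = mfderiv 𝓘(ℝ, E) 𝓘(ℝ, E) (extChartAt 𝓘(ℝ, E) x₀) q (X q) := by
  have h1 := (extChartAt 𝓘(ℝ, E) x₀).map_source hq
  have h2 := (extChartAt 𝓘(ℝ, E) x₀).left_inv hq
  have hinv := isInvertible_mfderivWithin_extChartAt_symm (I := 𝓘(ℝ, E)) h1
  have := mfderivWithin_extChartAt_symm_comp_mfderiv_extChartAt' (I := 𝓘(ℝ, E)) hq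
  have h3 : mfderivWithin 𝓘(ℝ, E) 𝓘(ℝ, E) (extChartAt 𝓘(ℝ, E) x₀).symm (range 𝓘(ℝ, E))
      (extChartAt 𝓘(ℝ, E) x₀ q) (mfderiv 𝓘(ℝ, E) 𝓘(ℝ, E) (extChartAt 𝓘(ℝ, E) x₀) q (X q)) = X q :=
    congrArg (fun L => L (X q)) this
  have h4 : (X ((extChartAt 𝓘(ℝ, E) x₀).symm (extChartAt 𝓘(ℝ, E) x₀ q)) : E) = X q := by rw [h2]
  refine hinv.inverse_apply_eq.2 ?_
  exact h4.trans h3.symm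

theorem SmoothVectorField.differentiableAt_localRep (X : SmoothVectorField E M) (x₀ : M) :
    DifferentiableAt ℝ (X.localRep x₀) (extChartAt 𝓘(ℝ, E) x₀ x₀) := by
  have h := (X.mdifferentiableAt (x := x₀)).mdifferentiableWithinAt (s := univ)
  have h' := h.differentiableWithinAt_mpullbackWithin_vectorField
  have e : ((extChartAt 𝓘(ℝ, E) x₀).symm ⁻¹' univ ∩ range 𝓘(ℝ, E)) = univ := by simp
  rw [e] at h'
  exact differentiableWithinAt_univ.1 h'

theorem SmoothVectorField.mfderiv_chart_lie (X Y : SmoothVectorField E M) (x₀ : M) :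
    mfderiv 𝓘(ℝ, E) 𝓘(ℝ, E) (extChartAt 𝓘(ℝ, E) x₀) x₀ (⁅X, Y⁆ x₀)
      = lieBracket ℝ (X.localRep x₀) (Y.localRep x₀) (extChartAt 𝓘(ℝ, E) x₀ x₀) := by
  have hinv := isInvertible_mfderiv_extChartAt (I := 𝓘(ℝ, E))
    (mem_extChartAt_source (I := 𝓘(ℝ, E)) x₀)
  have e : ((extChartAt 𝓘(ℝ, E) x₀).symm ⁻¹' univ ∩ range 𝓘(ℝ, E)) = univ := by simp
  have h1 : lieBracketWithin ℝ (X.localRep x₀) (Y.localRep x₀)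
      ((extChartAt 𝓘(ℝ, E) x₀).symm ⁻¹' univ ∩ range 𝓘(ℝ, E)) (extChartAt 𝓘(ℝ, E) x₀ x₀) =
      lieBracket ℝ (X.localRep x₀) (Y.localRep x₀) (extChartAt 𝓘(ℝ, E) x₀ x₀) := by
    rw [e, lieBracketWithin_univ]
  exact (hinv.self_apply_inverse _).trans h1

/-- Lie brackets of related vector fields are related. -/
theorem SmoothVectorField.Related.lie {f : M → M'} (hf : ContMDiff 𝓘(ℝ, E) 𝓘(ℝ, E') ∞ f)
    {X Y : SmoothVectorField E M} {v w : SmoothVectorField E' M'}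
    (hX : X.Related f v) (hY : Y.Related f w) : Related f ⁅X, Y⁆ ⁅v, w⁆ := by
  intro x₀
  let φ := extChartAt 𝓘(ℝ, E) x₀
  let ψ := extChartAt 𝓘(ℝ, E') (f x₀)
  let F : E → E' := ψ ∘ f ∘ φ.symm
  have hx₀ : x₀ ∈ φ.source := mem_extChartAt_source x₀
  have hFx₀ : F (φ x₀) = ψ (f x₀) := by simp [F, φ.left_inv hx₀]
  have hF : ContDiffAt ℝ ∞ F (φ x₀) := by
    have := (contMDiffAt_iff.1 (hf x₀)).2
    exact contDiffWithinAt_univ.1 (by simpa using! this)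
  have hFev : ∀ᶠ q in 𝓝 x₀, ContDiffAt ℝ 1 F (φ q) :=
    (continuousAt_extChartAt (I := 𝓘(ℝ, E)) x₀).eventually
      ((hF.of_le (m := 1) (by norm_cast)).eventually (by simp))
  have hsrc : ∀ᶠ q in 𝓝 x₀, q ∈ φ.source ∧ f q ∈ ψ.source :=
    Filter.Eventually.and (extChartAt_source_mem_nhds (I := 𝓘(ℝ, E)) x₀)
      (hf.continuous.continuousAt.eventually (extChartAt_source_mem_nhds (I := 𝓘(ℝ, E')) (f x₀)))
  have hD : ∀ᶠ q in 𝓝 x₀, ∀ a : TangentSpace 𝓘(ℝ, E) q,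
      fderiv ℝ F (φ q) (mfderiv 𝓘(ℝ, E) 𝓘(ℝ, E) φ q a)
        = mfderiv 𝓘(ℝ, E') 𝓘(ℝ, E') ψ (f q) (mfderiv 𝓘(ℝ, E) 𝓘(ℝ, E') f q a) := by
    filter_upwards [hFev, hsrc.eventually_nhds] with q hFq hq a
    obtain ⟨hq1, hq2⟩ := hq.self_of_nhds
    have d1 : HasMFDerivAt 𝓘(ℝ, E) 𝓘(ℝ, E) φ q (mfderiv 𝓘(ℝ, E) 𝓘(ℝ, E) φ q) :=
      (mdifferentiableAt_extChartAt (by simpa [φ] using hq1)).hasMFDerivAt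
    have d2 : HasMFDerivAt 𝓘(ℝ, E') 𝓘(ℝ, E') ψ (f q) (mfderiv 𝓘(ℝ, E') 𝓘(ℝ, E') ψ (f q)) :=
      (mdifferentiableAt_extChartAt (by simpa [ψ] using hq2)).hasMFDerivAt
    have d3 := (hf.mdifferentiableAt (x := q) (by simp)).hasMFDerivAt
    have d4 : HasMFDerivAt 𝓘(ℝ, E) 𝓘(ℝ, E') F (φ q) (fderiv ℝ F (φ q)) :=
      (hFq.differentiableAt (by simp)).hasFDerivAt.hasMFDerivAt
    have d5 := d4.comp q d1
    have d6 := d2.comp q d3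
    have d7 := d6.congr_of_eventuallyEq (f₁ := F ∘ φ) (by
      filter_upwards [hq] with p hp
      simp [F, φ.left_inv hp.1])
    exact congrArg (fun L => L a) (hasMFDerivAt_unique d5 d7)
  have hrel : ∀ {Z : SmoothVectorField E M} {z : SmoothVectorField E' M'}, Z.Related f z →
      ∀ᶠ y in 𝓝 (φ x₀), fderiv ℝ F y (Z.localRep x₀ y) = z.localRep (f x₀) (F y) := by
    intro Z z hZ
    have h : ∀ᶠ q in 𝓝 x₀, fderiv ℝ F (φ q) (Z.localRep x₀ (φ q))
        = z.localRep (f x₀) (F (φ q)) := by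
      filter_upwards [hD, hsrc] with q hq hs
      have e1 : F (φ q) = ψ (f q) := by simp [F, φ.left_inv hs.1]
      rw [e1]
      refine (congrArg (fderiv ℝ F (φ q)) (Z.localRep_chart x₀ q hs.1)).trans ?_
      refine (hq (Z q)).trans ?_
      refine Eq.trans ?_ (z.localRep_chart (f x₀) (f q) hs.2).symm
      exact congrArg (mfderiv 𝓘(ℝ, E') 𝓘(ℝ, E') ψ (f q)) (hZ q)
    have hc : Tendsto φ.symm (𝓝 (φ x₀)) (𝓝 x₀) := by
      have := continuousAt_extChartAt_symm (I := 𝓘(ℝ, E)) x₀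
      rw [ContinuousAt, φ.left_inv hx₀] at this
      exact this
    filter_upwards [hc.eventually h, extChartAt_target_mem_nhds (I := 𝓘(ℝ, E)) x₀] with y hy hyt
    rwa [φ.right_inv hyt] at hy
  have main := lieBracket_related (F := F) (x := φ x₀) (hF.of_le (by norm_cast))
    (X.differentiableAt_localRep x₀) (Y.differentiableAt_localRep x₀)
    (v := v.localRep (f x₀)) (w := w.localRep (f x₀))
    (by rw [hFx₀]; exact v.differentiableAt_localRep _)
    (by rw [hFx₀]; exact w.differentiableAt_localRep _) (hrel hX) (hrel hY)
  have hinv := isInvertible_mfderiv_extChartAt (I := 𝓘(ℝ, E'))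
    (mem_extChartAt_source (I := 𝓘(ℝ, E')) (f x₀))
  apply hinv.injective
  refine (hD.self_of_nhds (⁅X, Y⁆ x₀)).symm.trans ?_
  refine (congrArg (fderiv ℝ F (φ x₀)) (X.mfderiv_chart_lie Y x₀)).trans ?_
  refine main.trans ?_
  rw [hFx₀]
  exact (v.mfderiv_chart_lie w (f x₀)).symm

end Related

section FiniteCodim

variable {L : Type*} [LieRing L] [LieAlgebra ℝ L]

/-- A maximal finite-codimensional Lie subalgebra: a proper Lie subalgebra of finite codimension that
is not strictly contained in any other one. -/
def LieSubalgebra.IsMaximalFiniteCodim (T : LieSubalgebra ℝ L) : Prop :=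
  T ≠ ⊤ ∧ Module.Finite ℝ (L ⧸ T.toSubmodule) ∧
    ∀ T' : LieSubalgebra ℝ L, T' ≠ ⊤ → Module.Finite ℝ (L ⧸ T'.toSubmodule) → ¬ T < T'

/-- A maximal finite-codimensional Lie ideal: a proper Lie ideal of finite codimension that is not
strictly contained in any other one. -/
def LieIdeal.IsMaximalFiniteCodim (J : LieIdeal ℝ L) : Prop :=
  J ≠ ⊤ ∧ Module.Finite ℝ (L ⧸ J.toSubmodule) ∧
    ∀ J' : LieIdeal ℝ L, J' ≠ ⊤ → Module.Finite ℝ (L ⧸ J'.toSubmodule) → ¬ J < J'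

/-- For a Lie ideal `I` of `L` and a Lie ideal `J` of `I`, the normalizer of `J` in `L`, i.e. the Lie
subalgebra `{a ∈ L | [a, J] ⊆ J}` of `L`. -/
def LieIdeal.ambientNormalizer (I : LieIdeal ℝ L) (J : LieIdeal ℝ I) : LieSubalgebra ℝ L :=
  ((LieIdeal.toLieSubalgebra ℝ I J).map I.incl).normalizer

theorem LieIdeal.mem_ambientNormalizer (I : LieIdeal ℝ L) (J : LieIdeal ℝ I) (a : L) :
    a ∈ I.ambientNormalizer J ↔ ∀ k : I, k ∈ J → ∃ k' : I, k' ∈ J ∧ (k' : L) = ⁅a, (k : L)⁆ := by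
  simp [ambientNormalizer, LieSubalgebra.mem_normalizer_iff]

end FiniteCodim

/-- A smooth principal `G`-bundle `P → M`: a smooth right action of `G` on `P` and a smooth projection
that is invariant under it, such that around every point of `M` there is a `G`-equivariant
diffeomorphism `π⁻¹(U) ≃ U × G` over `U`. -/
structure SmoothPrincipalBundle
    (EM EG EP : Type*) [NormedAddCommGroup EM] [NormedSpace ℝ EM]
    [NormedAddCommGroup EG] [NormedSpace ℝ EG] [NormedAddCommGroup EP] [NormedSpace ℝ EP]
    (M G P : Type*) [TopologicalSpace M] [ChartedSpace EM M]
    [TopologicalSpace G] [ChartedSpace EG G] [Group G]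
    [TopologicalSpace P] [ChartedSpace EP P] where
  proj : P → M
  act : P → G → P
  act_one : ∀ u, act u 1 = u
  act_mul : ∀ u g h, act u (g * h) = act (act u g) h
  proj_act : ∀ u g, proj (act u g) = proj u
  contMDiff_proj : ContMDiff 𝓘(ℝ, EP) 𝓘(ℝ, EM) ∞ proj
  contMDiff_act : ContMDiff (𝓘(ℝ, EP).prod 𝓘(ℝ, EG)) 𝓘(ℝ, EP) ∞ fun p : P × G => act p.1 p.2
  exists_trivialization : ∀ m : M, ∃ e : Bundle.Trivialization G proj, m ∈ e.baseSet ∧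
    ContMDiffOn 𝓘(ℝ, EP) (𝓘(ℝ, EM).prod 𝓘(ℝ, EG)) ∞ e e.source ∧
    ContMDiffOn (𝓘(ℝ, EM).prod 𝓘(ℝ, EG)) 𝓘(ℝ, EP) ∞ e.toOpenPartialHomeomorph.symm e.target ∧
    ∀ u g, proj u ∈ e.baseSet → (e (act u g)).2 = (e u).2 * g

namespace SmoothPrincipalBundle

variable {EM EG EP : Type*} [NormedAddCommGroup EM] [NormedSpace ℝ EM] [FiniteDimensional ℝ EM]
  [NormedAddCommGroup EG] [NormedSpace ℝ EG]
  [NormedAddCommGroup EP] [NormedSpace ℝ EP] [FiniteDimensional ℝ EP]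
  {M G P : Type*} [TopologicalSpace M] [ChartedSpace EM M] [IsManifold 𝓘(ℝ, EM) ∞ M]
  [TopologicalSpace G] [ChartedSpace EG G] [Group G]
  [TopologicalSpace P] [ChartedSpace EP P] [IsManifold 𝓘(ℝ, EP) ∞ P]
  (B : SmoothPrincipalBundle EM EG EP M G P)

theorem contMDiff_act_right (g : G) : ContMDiff 𝓘(ℝ, EP) 𝓘(ℝ, EP) ∞ fun u => B.act u g :=
  B.contMDiff_act.comp (contMDiff_id.prodMk contMDiff_const)

theorem proj_surjective : Function.Surjective B.proj := fun m => by
  obtain ⟨e, hm, -⟩ := B.exists_trivialization m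
  exact ⟨e.toOpenPartialHomeomorph.symm (m, 1), e.proj_symm_apply' hm⟩

theorem exists_act_eq {u u' : P} (h : B.proj u = B.proj u') : ∃ g, B.act u g = u' := by
  obtain ⟨e, hm, -, -, he⟩ := B.exists_trivialization (B.proj u)
  refine ⟨(e u).2⁻¹ * (e u').2, ?_⟩
  have hu : B.act u ((e u).2⁻¹ * (e u').2) ∈ e.source := by
    rw [e.mem_source, B.proj_act]; exact hm
  have hu' : u' ∈ e.source := by rw [e.mem_source, ← h]; exact hm
  apply e.injOn hu hu'
  apply Prod.ext
  · exact (e.coe_fst hu).trans ((B.proj_act _ _).trans (h.trans (e.coe_fst hu').symm))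
  · exact (he _ _ hm).trans (mul_inv_cancel_left _ _)

/-- The Lie algebra `𝒜 = Γ(TP/G) = 𝔛_G(P)` of sections of the Atiyah algebroid: the Lie algebra of
the `G`-invariant vector fields on `P`, i.e. those with `T_u r_g (X_u) = X_{u.g}` for all `u`, `g`. The
value `X_m` at `m ∈ M` of the section given by `X` is the class of the vectors `X_u`, `π(u) = m`. -/
def atiyahAlgebra : LieSubalgebra ℝ (SmoothVectorField EP P) where
  carrier := {X | ∀ g, SmoothVectorField.Related (fun u => B.act u g) X X}
  zero_mem' g u := by simp
  add_mem' {X Y} hX hY g u := by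
    have h1 := hX g u
    have h2 := hY g u
    exact (map_add _ _ _).trans (congrArg₂ (· + ·) h1 h2)
  smul_mem' c X hX g u := (map_smul _ c _).trans (congrArg (c • ·) (hX g u))
  lie_mem' {X Y} hX hY g := (hX g).lie (B.contMDiff_act_right g) (hY g)

theorem exists_anchor (X : B.atiyahAlgebra) :
    ∃ v : SmoothVectorField EM M, (X : SmoothVectorField EP P).Related B.proj v := by
  have hcoh : ∀ u u' : P, B.proj u = B.proj u' →
      (mfderiv 𝓘(ℝ, EP) 𝓘(ℝ, EM) B.proj u (X.1 u) : EM)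
        = mfderiv 𝓘(ℝ, EP) 𝓘(ℝ, EM) B.proj u' (X.1 u') := by
    intro u u' h
    obtain ⟨g, rfl⟩ := B.exists_act_eq h
    have hg : MDifferentiableAt 𝓘(ℝ, EP) 𝓘(ℝ, EP) (fun u => B.act u g) u :=
      (B.contMDiff_act_right g).mdifferentiableAt (by simp)
    have hp : MDifferentiableAt 𝓘(ℝ, EP) 𝓘(ℝ, EM) B.proj (B.act u g) :=
      B.contMDiff_proj.mdifferentiableAt (by simp)
    have d := hp.hasMFDerivAt.comp u hg.hasMFDerivAt
    have e : B.proj ∘ (fun u => B.act u g) = B.proj := funext fun u => B.proj_act u g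
    rw [e] at d
    have d' := (B.contMDiff_proj.mdifferentiableAt (x := u) (by simp)).hasMFDerivAt
    have := congrArg (fun L => L (X.1 u)) (hasMFDerivAt_unique d' d)
    refine Eq.trans this ?_
    exact congrArg (mfderiv 𝓘(ℝ, EP) 𝓘(ℝ, EM) B.proj (B.act u g)) (X.2 g u)
  let s : M → P := Function.surjInv B.proj_surjective
  have hs : ∀ m, B.proj (s m) = m := Function.surjInv_eq B.proj_surjective
  let v : ∀ m : M, TangentSpace 𝓘(ℝ, EM) m :=
    fun m => (mfderiv 𝓘(ℝ, EP) 𝓘(ℝ, EM) B.proj (s m) (X.1 (s m)) : EM)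
  have hv : ∀ u, mfderiv 𝓘(ℝ, EP) 𝓘(ℝ, EM) B.proj u (X.1 u) = v (B.proj u) :=
    fun u => hcoh u (s (B.proj u)) (hs _).symm
  refine ⟨⟨v, fun m => ?_⟩, hv⟩
  obtain ⟨e, hm, -, he, -⟩ := B.exists_trivialization m
  let σ : M → P := fun x => e.toOpenPartialHomeomorph.symm (x, 1)
  have hσ : ContMDiffAt 𝓘(ℝ, EM) 𝓘(ℝ, EP) ∞ σ m := by
    have h1 : ContMDiffAt (𝓘(ℝ, EM).prod 𝓘(ℝ, EG)) 𝓘(ℝ, EP) ∞ e.toOpenPartialHomeomorph.symm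
        (m, (1 : G)) := he.contMDiffAt (e.open_target.mem_nhds (by rw [e.mem_target]; exact hm))
    exact h1.comp m (contMDiffAt_id.prodMk contMDiffAt_const)
  have hT : ContMDiff 𝓘(ℝ, EP).tangent 𝓘(ℝ, EM).tangent ∞ (tangentMap 𝓘(ℝ, EP) 𝓘(ℝ, EM) B.proj) :=
    B.contMDiff_proj.contMDiff_tangentMap (by rfl)
  have hX := X.1.contMDiff
  have hc := hT.contMDiffAt.comp m ((hX (σ m)).comp m hσ)
  refine hc.congr_of_eventuallyEq ?_
  filter_upwards [e.open_baseSet.mem_nhds hm] with x hx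
  have hpx : B.proj (σ x) = x := e.proj_symm_apply' hx
  have h2 : (⟨B.proj (σ x), v (B.proj (σ x))⟩ : TangentBundle 𝓘(ℝ, EM) M) = ⟨x, v x⟩ := by rw [hpx]
  refine h2.symm.trans ?_
  exact congrArg (Bundle.TotalSpace.mk' EM (B.proj (σ x))) (hv (σ x)).symm

theorem eq_of_related {X : SmoothVectorField EP P} {v w : SmoothVectorField EM M}
    (hv : X.Related B.proj v) (hw : X.Related B.proj w) : v = w := by
  ext m
  obtain ⟨u, rfl⟩ := B.proj_surjective m
  exact (hv u).symm.trans (hw u)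

/-- The anchor `π_* : 𝒜 → 𝔛(M)`, see `anchor_proj`: `(π_* X)_{π(u)} = T_u π (X_u)`. -/
def anchor : B.atiyahAlgebra →ₗ⁅ℝ⁆ SmoothVectorField EM M where
  toFun X := (B.exists_anchor X).choose
  map_add' X Y := B.eq_of_related (B.exists_anchor (X + Y)).choose_spec fun u =>
    (map_add _ _ _).trans
      (congrArg₂ (· + ·) ((B.exists_anchor X).choose_spec u) ((B.exists_anchor Y).choose_spec u))
  map_smul' c X := B.eq_of_related (B.exists_anchor (c • X)).choose_spec fun u =>
    (map_smul _ c _).trans (congrArg (c • ·) ((B.exists_anchor X).choose_spec u))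
  map_lie' {X Y} := B.eq_of_related (B.exists_anchor ⁅X, Y⁆).choose_spec
    ((B.exists_anchor X).choose_spec.lie B.contMDiff_proj (B.exists_anchor Y).choose_spec)

theorem anchor_proj (X : B.atiyahAlgebra) (u : P) :
    B.anchor X (B.proj u) = mfderiv 𝓘(ℝ, EP) 𝓘(ℝ, EM) B.proj u (X.1 u) :=
  ((B.exists_anchor X).choose_spec u).symm

/-- The kernel `𝒦` of the anchor, as a Lie ideal of `𝒜`. -/
abbrev kernelAlgebra : LieIdeal ℝ B.atiyahAlgebra := B.anchor.ker

/-- The Lie subalgebra `𝒜_m = {a ∈ 𝒜 | (π_* a)_m = 0}` of `𝒜`. -/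
def isotropySubalgebra (m : M) : LieSubalgebra ℝ B.atiyahAlgebra where
  carrier := {a | B.anchor a m = 0}
  zero_mem' := by simp
  add_mem' {a b} ha hb := by
    simp only [mem_ofPred_eq] at ha hb ⊢
    simp [ha, hb]
  smul_mem' c a ha := by
    simp only [mem_ofPred_eq] at ha ⊢
    simp [ha]
  lie_mem' {a b} ha hb := by
    simp only [mem_ofPred_eq] at ha hb ⊢
    rw [LieHom.map_lie, SmoothVectorField.lie_apply, ← mlieBracketWithin_univ]
    exact mlieBracketWithin_eq_zero_of_eq_zero ha hb

/-- The subspace `𝒦(m) = {k ∈ 𝒦 | k_m = 0}` of `𝒦`. Here `k_m ∈ (TP/G)_m` is the class of the vectors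
`k_u`, `π(u) = m`, so it vanishes if and only if all of these do. -/
def kernelVanishingAt (m : M) : Submodule ℝ B.kernelAlgebra where
  carrier := {k | ∀ u : P, B.proj u = m → k.1.1 u = 0}
  zero_mem' u _ := by simp
  add_mem' {k l} hk hl u hu := by
    have h1 := hk u hu
    have h2 := hl u hu
    simp [h1, h2]
  smul_mem' c k hk u hu := by
    have h1 := hk u hu
    simp [h1]

/-- The maximal finite-codimensional Lie ideals `J` of `𝒦` that are normalized by the Lie subalgebra
`T` of `𝒜`, i.e. with `[T, J] ⊆ J`. -/
def normalizedMaximalIdeals (T : LieSubalgebra ℝ B.atiyahAlgebra) :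
    Set (LieIdeal ℝ B.kernelAlgebra) :=
  {J | J.IsMaximalFiniteCodim ∧ T ≤ B.kernelAlgebra.ambientNormalizer J}

end SmoothPrincipalBundle

end AtiyahDefinitions

/-!
For a subspace `S` of a module `V` over `C^∞(M)`, consider the multiplier ideal `{f | f V ⊆ S}`.
If `T` is a Lie subalgebra of finite codimension in `𝒜`, passing twice to `{x ∈ T | [x, 𝒜] ⊆ T}`
shows that for every `g`, `a`, `h` some nonzero polynomial `p` satisfies `p(g)² (a·h)² 𝒜 ⊆ T`.
Since `M` has positive dimension, a general choice of finitely many `aᵢ`, `hᵢ` makes `∑ (aᵢ·hᵢ)²`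
invertible, so that the quotient of `C^∞(M)` by the multiplier ideal of `T` is algebraic over `ℝ`.
A proper ideal of `C^∞(M)` with algebraic quotient has a common zero `m`, as one sees from `p(ρ)`
for a proper function `ρ`, and derivations preserving such an ideal vanish at `m`. Hence `T ⊆ 𝒜_m`.

The same argument, applied to an ideal `J` of `𝒦` normalized by `𝒜_m`, shows that the multiplier
ideal of `J` has `m` as its only common zero and that the normalizer of `J` is `𝒜_m`. As `𝔤` is
perfect, `J` does not contain `[𝒦, 𝒦]`; maximality then makes `J` a `C^∞(M)`-submodule with radical
multiplier ideal, which thus contains all functions vanishing at `m`, so that `𝒦(m) ⊆ J`.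
Conversely, evaluation at a point of the fibre over `m` maps `𝒦` onto `𝔤` with kernel `𝒦(m)`, and
the preimages of the maximal ideals of the semisimple algebra `𝔤` have intersection `𝒦(m)`. They are
normalized by `𝒜_m` because every ideal `I` of `𝔤` satisfies `I = [I, I]`.
-/

open Polynomial

section FiniteCodimension

variable {𝕜 V W : Type*} [Field 𝕜] [AddCommGroup V] [Module 𝕜 V] [AddCommGroup W] [Module 𝕜 W]

theorem cofg_comap {S : Submodule 𝕜 W} (hS : S.CoFG) (f : V →ₗ[𝕜] W) : (S.comap f).CoFG := by
  have : Module.Finite 𝕜 (W ⧸ S) := hS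
  simpa only [LinearMap.ker_comp, Submodule.ker_mkQ] using Submodule.CoFG.ker (S.mkQ.comp f)

theorem cofg_map {f : V →ₗ[𝕜] W} (hf : (LinearMap.range f).CoFG) {S : Submodule 𝕜 V}
    (hS : S.CoFG) : (S.map f).CoFG := by
  have : Module.Finite 𝕜 (V ⧸ S) := hS
  have : Module.Finite 𝕜 (W ⧸ LinearMap.range f) := hf
  have hle : S.map f ≤ LinearMap.range f := LinearMap.map_le_range
  have hexact : Function.Exact (S.mapQ (S.map f) f (Submodule.le_comap_map f S))
      (Submodule.factor hle) := by
    intro w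
    constructor
    · obtain ⟨w, rfl⟩ := Submodule.mkQ_surjective _ w
      intro hw
      obtain ⟨v, rfl⟩ := (Submodule.Quotient.mk_eq_zero _).1 hw
      exact ⟨Submodule.Quotient.mk v, rfl⟩
    · rintro ⟨v, rfl⟩
      obtain ⟨v, rfl⟩ := Submodule.mkQ_surjective _ v
      exact (Submodule.Quotient.mk_eq_zero _).2 ⟨v, rfl⟩
  exact Module.Finite.of_exact hexact (Submodule.factor_surjective hle)

theorem exists_aeval_mem_of_cofg {R : Type*} [CommRing R] [Algebra 𝕜 R] {W : Submodule 𝕜 R}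
    (hW : W.CoFG) (g : R) : ∃ p : 𝕜[X], p ≠ 0 ∧ aeval g p ∈ W := by
  have : Module.Finite 𝕜 (R ⧸ W) := hW
  have hφ : ¬ Function.Injective (W.mkQ.comp (aeval g).toLinearMap) := fun h =>
    have := Module.Finite.of_injective _ h
    Polynomial.not_finite this
  rw [← LinearMap.ker_eq_bot, Submodule.eq_bot_iff] at hφ
  push Not at hφ
  obtain ⟨p, hp, hp0⟩ := hφ
  exact ⟨p, hp0, (Submodule.Quotient.mk_eq_zero W).1 hp⟩

theorem isAlgebraic_quotient_iff {R : Type*} [CommRing R] [Algebra 𝕜 R] {J : Ideal R} :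
    Algebra.IsAlgebraic 𝕜 (R ⧸ J) ↔ ∀ g : R, ∃ p : 𝕜[X], p ≠ 0 ∧ aeval g p ∈ J := by
  have hmem (g : R) (p : 𝕜[X]) : aeval (Ideal.Quotient.mk J g) p = 0 ↔ aeval g p ∈ J := by
    rw [← Ideal.Quotient.mkₐ_eq_mk 𝕜, aeval_algHom_apply, Ideal.Quotient.mkₐ_eq_mk,
      Ideal.Quotient.eq_zero_iff_mem]
  rw [Algebra.isAlgebraic_def, Ideal.Quotient.mk_surjective.forall]
  simp only [IsAlgebraic, hmem]

end FiniteCodimension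

section Transporter

variable {𝕜 L V : Type*} [Field 𝕜] [LieRing L] [LieAlgebra 𝕜 L] [AddCommGroup V] [Module 𝕜 V]
  [LieRingModule L V] [LieModule 𝕜 L V]

/-- The Lie subalgebra of the elements of `L` that map the `L`-module `V` into the subspace `S`. -/
def lieTransporter (L : Type*) [LieRing L] [LieAlgebra 𝕜 L] [LieRingModule L V] [LieModule 𝕜 L V]
    (S : Submodule 𝕜 V) : LieSubalgebra 𝕜 L where
  carrier := {x | ∀ v : V, ⁅x, v⁆ ∈ S}
  zero_mem' v := by simp
  add_mem' hx hy v := by rw [add_lie]; exact S.add_mem (hx v) (hy v)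
  smul_mem' c x hx v := by rw [smul_lie]; exact S.smul_mem c (hx v)
  lie_mem' hx hy v := by rw [lie_lie]; exact S.sub_mem (hx _) (hy _)

theorem cofg_inf_lieTransporter {T : LieSubalgebra 𝕜 L} (hT : T.toSubmodule.CoFG)
    {S : Submodule 𝕜 V} (hS : S.CoFG) (hTS : ∀ x ∈ T, ∀ v ∈ S, ⁅x, v⁆ ∈ S) :
    (T ⊓ lieTransporter L S).toSubmodule.CoFG := by
  have : Module.Finite 𝕜 (V ⧸ S) := hS
  let act (x : T) : V ⧸ S →ₗ[𝕜] V ⧸ S := S.mapQ S (LieModule.toEnd 𝕜 L V x) (hTS x x.2)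
  let ρ : T.toSubmodule →ₗ[𝕜] Module.End 𝕜 (V ⧸ S) :=
    { toFun := act
      map_add' x y := Submodule.linearMap_qext _ <| LinearMap.ext fun v =>
        congrArg S.mkQ (add_lie (x : L) (y : L) v)
      map_smul' c x := Submodule.linearMap_qext _ <| LinearMap.ext fun v =>
        congrArg S.mkQ (smul_lie c (x : L) v) }
  have hker : ((LinearMap.ker ρ).map T.toSubmodule.subtype).CoFG :=
    cofg_map (by rwa [Submodule.range_subtype]) (Submodule.CoFG.ker ρ)
  refine hker.of_le ?_
  rintro _ ⟨x, hx, rfl⟩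
  exact ⟨x.2, fun v => (Submodule.Quotient.mk_eq_zero S).1
    (LinearMap.congr_fun (LinearMap.mem_ker.1 hx) (Submodule.Quotient.mk v))⟩

/-- The Lie subalgebra `{x ∈ T | [x, L] ⊆ T}` of a Lie subalgebra `T` of `L`, a substitute for the
largest ideal of `L` contained in `T` which is still of finite codimension when `T` is. -/
def idealCore (T : LieSubalgebra 𝕜 L) : LieSubalgebra 𝕜 L :=
  T ⊓ lieTransporter L T.toSubmodule

theorem cofg_idealCore {T : LieSubalgebra 𝕜 L} (hT : T.toSubmodule.CoFG) :
    (idealCore T).toSubmodule.CoFG :=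
  cofg_inf_lieTransporter hT hT fun _ hx _ hy => T.lie_mem hx hy

end Transporter

section LieRinehart

/-- A module `V` over both the functions `R` and the Lie algebra `L` of a Lie–Rinehart pair, on
which `L` acts by first-order operators whose symbol is the anchor. -/
class IsLeibnizModule (R L V : Type*) [CommRing R] [LieRing L] [LieRingModule L R]
    [AddCommGroup V] [Module R V] [LieRingModule L V] : Prop where
  lie_smul_right (x : L) (f : R) (v : V) : ⁅x, f • v⁆ = f • ⁅x, v⁆ + ⁅x, f⁆ • v

/-- A representation `V` of a Lie–Rinehart pair `(R, L)`, that is a flat `L`-connection on `V`: the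
action is moreover `R`-linear in `L`. -/
class IsLieRinehartModule (R L V : Type*) [CommRing R] [LieRing L] [Module R L] [LieRingModule L R]
    [AddCommGroup V] [Module R V] [LieRingModule L V] : Prop extends IsLeibnizModule R L V where
  smul_lie_left (f : R) (x : L) (v : V) : ⁅f • x, v⁆ = f • ⁅x, v⁆

instance {R L : Type*} [CommRing R] [LieRing L] [Module R L] [LieRingModule L R]
    [LieRinehartRing R L] : IsLeibnizModule R L L where
  lie_smul_right x f y := LieRinehartRing.leibniz_smul_right x y f


/-- The ideal of the functions `f` that multiply `V` into the subspace `S`. Its common zeros are the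
points that `S` singles out. -/
def multiplierIdeal (R : Type*) {𝕜 V : Type*} [CommRing R] [Semiring 𝕜] [AddCommGroup V]
    [Module 𝕜 V] [Module R V] (S : Submodule 𝕜 V) : Ideal R where
  carrier := {f | ∀ v : V, f • v ∈ S}
  zero_mem' v := by simp
  add_mem' hf hg v := by rw [add_smul]; exact S.add_mem (hf v) (hg v)
  smul_mem' g f hf v := by
    rw [smul_eq_mul, mul_comm, mul_smul]
    exact hf _

theorem multiplierIdeal_ne_top {R 𝕜 V : Type*} [CommRing R] [Semiring 𝕜] [AddCommGroup V]
    [Module 𝕜 V] [Module R V] {S : Submodule 𝕜 V} (hS : S ≠ ⊤) : multiplierIdeal R S ≠ ⊤ :=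
  fun htop => hS <| eq_top_iff.2 fun v _ => by
    have hone : (1 : R) ∈ multiplierIdeal R S := htop ▸ Submodule.mem_top
    simpa only [one_smul] using hone v

end LieRinehart

section Multiplier

variable {𝕜 R L : Type*} [Field 𝕜] [CommRing R] [LieRing L] [LieRingModule L R]

theorem lie_mem_multiplierIdeal {V : Type*} [AddCommGroup V] [Module 𝕜 V] [Module R V]
    [LieRingModule L V] [IsLeibnizModule R L V] {S : Submodule 𝕜 V} {x : L}
    (hx : ∀ v ∈ S, ⁅x, v⁆ ∈ S) {f : R} (hf : f ∈ multiplierIdeal R S) :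
    ⁅x, f⁆ ∈ multiplierIdeal R S := by
  intro v
  have h := S.sub_mem (hx _ (hf v)) (hf ⁅x, v⁆)
  rwa [IsLeibnizModule.lie_smul_right, add_sub_cancel_left] at h

variable [LieAlgebra 𝕜 L] [Module R L]

theorem mul_lie_mem_multiplierIdeal {V : Type*} [AddCommGroup V] [Module 𝕜 V] [Module R V]
    [LieRingModule L V] [LieModule 𝕜 L V] [IsLieRinehartModule R L V] {S : Submodule 𝕜 V} {f : R}
    (hf : f ∈ multiplierIdeal R (lieTransporter L S).toSubmodule) (x : L) (h : R) :
    f * ⁅x, h⁆ ∈ multiplierIdeal R S := by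
  intro v
  have hmem := S.sub_mem (hf x (h • v)) (hf (h • x) v)
  have hexpand : ⁅f • x, h • v⁆ - ⁅f • h • x, v⁆ = (f * ⁅x, h⁆) • v := by
    rw [IsLieRinehartModule.smul_lie_left, IsLieRinehartModule.smul_lie_left,
      IsLieRinehartModule.smul_lie_left, IsLeibnizModule.lie_smul_right, smul_add,
      add_sub_cancel_left, smul_smul]
  rwa [hexpand] at hmem

variable [LieRinehartRing R L]

theorem smul_lie_eq_sub (f : R) (x y : L) : ⁅f • x, y⁆ = f • ⁅x, y⁆ - ⁅y, f⁆ • x := by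
  rw [← lie_skew, LieRinehartRing.leibniz_smul_right, ← lie_skew x y, smul_neg]
  abel

theorem lie_mul_mem_multiplierIdeal {T : LieSubalgebra 𝕜 L} {u : R} {x : L}
    (hu : ∀ r : R, (u * r) • x ∈ idealCore T) (h : R) :
    u * ⁅x, h⁆ ∈ multiplierIdeal R T.toSubmodule := by
  intro y
  have hmem := T.add_mem (T.sub_mem ((hu 1).2 (h • y)) ((hu h).2 y)) (hu (-⁅y, h⁆)).1
  have hexpand : ⁅(u * 1) • x, h • y⁆ - ⁅(u * h) • x, y⁆ + (u * -⁅y, h⁆) • x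
      = (u * ⁅x, h⁆) • y := by
    simp only [LieRinehartRing.leibniz_smul_right, smul_lie_eq_sub, mul_one,
      LieRinehartRing.lie_smul_eq_mul, LieRinehartRing.leibniz_mul_right, smul_eq_mul, smul_sub,
      smul_smul, mul_neg, neg_smul, add_smul, mul_comm h u, mul_comm h ⁅y, u⁆]
    abel
  rwa [hexpand] at hmem

theorem sq_mul_lie_mul_smul_mem [NeZero (2 : 𝕜)] {S : Submodule 𝕜 L} {f h : R} {x : L}
    (hf : f • x ∈ lieTransporter L S) (hfh : (f * h) • x ∈ lieTransporter L S) (r : R) :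
    (f ^ 2 * ⁅x, h⁆ * r) • x ∈ S := by
  have hmem := S.sub_mem (hf ((f * h * r) • x)) (hfh ((f * r) • x))
  have hexpand : ⁅f • x, (f * h * r) • x⁆ - ⁅(f * h) • x, (f * r) • x⁆
      = (2 : 𝕜) • ((f ^ 2 * ⁅x, h⁆ * r) • x) := by
    simp only [LieRinehartRing.leibniz_smul_right, smul_lie_eq_sub, lie_self, smul_zero, zero_sub,
      LieRinehartRing.lie_smul_eq_mul, LieRinehartRing.leibniz_mul_right, smul_eq_mul, smul_smul,
      ← neg_smul, ← add_smul, ← sub_smul, two_smul]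
    congr 1
    ring
  rwa [hexpand, S.smul_mem_iff (NeZero.ne _)] at hmem

theorem sq_mul_sq_mem_multiplierIdeal [NeZero (2 : 𝕜)] {T : LieSubalgebra 𝕜 L} {f h : R} {x : L}
    (hf : f • x ∈ idealCore (idealCore T)) (hfh : (f * h) • x ∈ idealCore (idealCore T)) :
    f ^ 2 * ⁅x, h⁆ ^ 2 ∈ multiplierIdeal R T.toSubmodule := by
  rw [pow_two ⁅x, h⁆, ← mul_assoc]
  exact lie_mul_mem_multiplierIdeal (sq_mul_lie_mul_smul_mem hf.2 hfh.2) h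

variable [Algebra 𝕜 R] [LieRinehartAlgebra 𝕜 R L]

theorem isAlgebraic_quotient_multiplierIdeal [NeZero (2 : 𝕜)] {T : LieSubalgebra 𝕜 L}
    (hT : T.toSubmodule.CoFG) {ι : Type*} [Fintype ι] (x : ι → L) (h : ι → R)
    (hunit : IsUnit (∑ i, ⁅x i, h i⁆ ^ 2)) :
    Algebra.IsAlgebraic 𝕜 (R ⧸ multiplierIdeal R T.toSubmodule) := by
  classical
  refine isAlgebraic_quotient_iff.2 fun g => ?_
  have hcore := cofg_idealCore (cofg_idealCore hT)
  have hpoly : ∀ i, ∃ p : 𝕜[X], p ≠ 0 ∧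
      aeval g p ^ 2 * ⁅x i, h i⁆ ^ 2 ∈ multiplierIdeal R T.toSubmodule := by
    intro i
    let a : R →ₗ[𝕜] L := (LinearMap.toSpanSingleton R L (x i)).restrictScalars 𝕜
    obtain ⟨p, hp, hpx, hphx⟩ := exists_aeval_mem_of_cofg
      ((cofg_comap hcore a).inf (cofg_comap hcore (a.comp (LinearMap.mulRight 𝕜 (h i))))) g
    exact ⟨p, hp, sq_mul_sq_mem_multiplierIdeal hpx hphx⟩
  choose p hp hmem using hpoly
  refine ⟨∏ i, p i ^ 2, Finset.prod_ne_zero_iff.2 fun i _ => pow_ne_zero _ (hp i), ?_⟩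
  rw [← Ideal.mul_unit_mem_iff_mem _ hunit, Finset.mul_sum]
  refine Ideal.sum_mem _ fun i _ => ?_
  rw [map_prod, ← Finset.mul_prod_erase _ _ (Finset.mem_univ i), mul_right_comm, map_pow]
  exact Ideal.mul_mem_right _ _ (hmem i)

theorem isAlgebraic_quotient_multiplierIdeal_of_isLieRinehartModule [NeZero (2 : 𝕜)]
    {V : Type*} [AddCommGroup V] [Module 𝕜 V] [Module R V] [LieRingModule L V] [LieModule 𝕜 L V]
    [IsLieRinehartModule R L V] {S : Submodule 𝕜 V} (hS : S.CoFG) {T : LieSubalgebra 𝕜 L}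
    (hT : T.toSubmodule.CoFG) (hTS : ∀ x ∈ T, ∀ v ∈ S, ⁅x, v⁆ ∈ S) {ι : Type*} [Fintype ι]
    (x : ι → L) (h : ι → R) (hunit : IsUnit (∑ i, ⁅x i, h i⁆ ^ 2)) :
    Algebra.IsAlgebraic 𝕜 (R ⧸ multiplierIdeal R S) := by
  have htransporter : (lieTransporter L S).toSubmodule.CoFG :=
    (cofg_inf_lieTransporter hT hS hTS).of_le inf_le_right
  have halg := isAlgebraic_quotient_iff.1
    (isAlgebraic_quotient_multiplierIdeal htransporter x h hunit)
  refine isAlgebraic_quotient_iff.2 fun g => ?_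
  obtain ⟨p, hp, hpg⟩ := halg g
  refine ⟨p, hp, ?_⟩
  rw [← Ideal.mul_unit_mem_iff_mem _ hunit, Finset.mul_sum]
  refine Ideal.sum_mem _ fun i _ => ?_
  rw [pow_two, ← mul_assoc]
  exact Ideal.mul_mem_right _ _ (mul_lie_mem_multiplierIdeal hpg (x i) (h i))

end Multiplier

section Differential

variable {𝕜 R : Type*} [Field 𝕜] [CharZero 𝕜] [CommRing R] [Algebra 𝕜 R] {J : Ideal R}
  {d : Derivation 𝕜 R R}

/-- Differentiating `s * p(g)` trades `p` for its derivative, at the cost of the factor `d g`. -/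
theorem mul_aeval_notMem_of_derivation_ne_zero (hd : ∀ f ∈ J, d f ∈ J) {ev : R →ₐ[𝕜] 𝕜}
    (hev : ∀ f ∈ J, ev f = 0) {g : R} (hg : ev (d g) ≠ 0) {p : 𝕜[X]} (hp : p ≠ 0) {s : R}
    (hs : ev s ≠ 0) : s * aeval g p ∉ J := by
  induction hn : p.natDegree generalizing p s with
  | zero =>
    intro hmem
    rw [Polynomial.eq_C_of_natDegree_eq_zero hn] at hmem hp
    have h := hev _ hmem
    simp only [aeval_C, map_mul, AlgHom.commutes] at h
    exact mul_ne_zero hs (fun h0 => hp (by simpa using h0)) h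
  | succ n ih =>
    intro hmem
    have hderiv : (derivative p).natDegree = n := by
      rw [natDegree_derivative, hn, Nat.add_sub_cancel]
    refine ih (fun h => ?_) (s := s ^ 2 * d g) (by simpa [hs] using hg) hderiv ?_
    · rw [Polynomial.derivative_eq_zero.1 h] at hn
      omega
    · have hleibniz : s ^ 2 * d g * aeval g (derivative p)
          = s * d (s * aeval g p) - d s * (s * aeval g p) := by
        rw [Derivation.leibniz, Derivation.map_aeval]
        simp only [smul_eq_mul]
        ring
      rw [hleibniz]
      exact J.sub_mem (J.mul_mem_left _ (hd _ hmem)) (J.mul_mem_left _ hmem)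

theorem eval_derivation_eq_zero [Algebra.IsAlgebraic 𝕜 (R ⧸ J)] (hd : ∀ f ∈ J, d f ∈ J)
    (ev : R →ₐ[𝕜] 𝕜) (hev : ∀ f ∈ J, ev f = 0) (g : R) : ev (d g) = 0 := by
  by_contra hg
  obtain ⟨p, hp, hmem⟩ := isAlgebraic_quotient_iff.1 ‹Algebra.IsAlgebraic 𝕜 (R ⧸ J)› g
  exact mul_aeval_notMem_of_derivation_ne_zero hd hev hg hp (s := 1) (by simp) (by simpa using hmem)

end Differential

section MaximalIdeal

variable {K : Type*} [LieRing K] [LieAlgebra ℝ K] {J : LieIdeal ℝ K}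

theorem eq_or_eq_top_of_isMaximalFiniteCodim (hJ : J.IsMaximalFiniteCodim) {I : LieIdeal ℝ K}
    (h : J ≤ I) : I = J ∨ I = ⊤ := by
  by_contra! hne
  exact hJ.2.2 I hne.2 (Submodule.CoFG.of_le (S := J.toSubmodule) h hJ.2.1)
    (lt_of_le_of_ne h hne.1.symm)

variable {R : Type*} [CommRing R] [LieAlgebra R K]

/-- By maximality `J` equals the ideal `{x | [K, x] ⊆ J}`, which is visibly `R`-stable. -/
theorem smul_mem_of_isMaximalFiniteCodim (hJ : J.IsMaximalFiniteCodim)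
    (hperfect : ∃ x y : K, ⁅x, y⁆ ∉ J) (f : R) {x : K} (hx : x ∈ J) : f • x ∈ J := by
  have hnormalizer : LieSubmodule.normalizer J ≠ ⊤ := by
    obtain ⟨x, y, hxy⟩ := hperfect
    intro h
    exact hxy ((LieSubmodule.mem_normalizer J y).1 (h ▸ LieSubmodule.mem_top y) x)
  rw [← (eq_or_eq_top_of_isMaximalFiniteCodim hJ J.le_normalizer).resolve_right hnormalizer,
    LieSubmodule.mem_normalizer]
  intro y
  rw [lie_smul, ← smul_lie]
  exact J.lie_mem hx

variable [Algebra ℝ R] [IsScalarTower ℝ R K]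

theorem isRadical_multiplierIdeal (hJ : J.IsMaximalFiniteCodim)
    (hperfect : ∃ x y : K, ⁅x, y⁆ ∉ J) : (multiplierIdeal R J.toSubmodule).IsRadical := by
  rintro f ⟨n, hn⟩
  let smulHom : K →ₗ⁅ℝ, K⁆ K :=
    { (LinearMap.lsmul R K f).restrictScalars ℝ with map_lie' := (lie_smul f _ _).symm }
  rcases eq_or_eq_top_of_isMaximalFiniteCodim hJ (le_sup_left : J ≤ J ⊔ smulHom.range) with h | h
  · exact fun x => (h ▸ le_sup_right : smulHom.range ≤ J) ⟨x, rfl⟩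
  · have hdescend : ∀ m, f ^ m ∈ multiplierIdeal R J.toSubmodule → ∀ x, x ∈ J := by
      intro m
      induction m with
      | zero => exact fun hm x => by simpa using hm x
      | succ m ih =>
        refine fun hm => ih fun x => ?_
        obtain ⟨j, hj, _, ⟨y, rfl⟩, rfl⟩ :=
          (LieSubmodule.mem_sup _ _ x).1 (h ▸ LieSubmodule.mem_top x)
        have hfy : f ^ m • smulHom y = f ^ (m + 1) • y := by rw [pow_succ, mul_smul]; rfl
        rw [smul_add, hfy]
        exact add_mem (smul_mem_of_isMaximalFiniteCodim hJ hperfect _ hj) (hm y)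
    exact (hJ.1 (eq_top_iff.2 fun x _ => hdescend n hn x)).elim

end MaximalIdeal

noncomputable section VectorFields

namespace SmoothVectorField

variable {E : Type*} [NormedAddCommGroup E] [NormedSpace ℝ E]
  {M : Type*} [TopologicalSpace M] [ChartedSpace E M] [IsManifold 𝓘(ℝ, E) ∞ M]

instance : SMul C^∞⟮𝓘(ℝ, E), M; ℝ⟯ (SmoothVectorField E M) where
  smul f X := ⟨fun m => f m • X m, f.contMDiff.smul_section X.contMDiff⟩

theorem smul_apply (f : C^∞⟮𝓘(ℝ, E), M; ℝ⟯) (X : SmoothVectorField E M) (m : M) :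
    (f • X) m = f m • X m := rfl

instance : Module C^∞⟮𝓘(ℝ, E), M; ℝ⟯ (SmoothVectorField E M) where
  one_smul _ := ContMDiffSection.ext fun _ => one_smul ℝ _
  mul_smul f _ _ := ContMDiffSection.ext fun m => mul_smul (f m) _ _
  smul_zero f := ContMDiffSection.ext fun m => smul_zero (f m)
  smul_add f _ _ := ContMDiffSection.ext fun m => smul_add (f m) _ _
  add_smul f _ _ := ContMDiffSection.ext fun m => add_smul (f m) _ _
  zero_smul _ := ContMDiffSection.ext fun _ => zero_smul ℝ _

instance : IsScalarTower ℝ C^∞⟮𝓘(ℝ, E), M; ℝ⟯ (SmoothVectorField E M) where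
  smul_assoc c f X := ContMDiffSection.ext fun m => smul_assoc c (f m) (X m)

theorem contMDiff_mvfderiv_apply {F : Type*} [NormedAddCommGroup F] [NormedSpace ℝ F] {f : M → F}
    (hf : ContMDiff 𝓘(ℝ, E) 𝓘(ℝ, F) ∞ f) (X : SmoothVectorField E M) :
    ContMDiff 𝓘(ℝ, E) 𝓘(ℝ, F) ∞ fun m => mvfderiv 𝓘(ℝ, E) f m (X m) :=
  (contMDiff_snd_tangentBundle_modelSpace F 𝓘(ℝ, F)).comp
    ((hf.contMDiff_tangentMap (by rfl)).comp X.contMDiff)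

instance : Bracket (SmoothVectorField E M) C^∞⟮𝓘(ℝ, E), M; ℝ⟯ where
  bracket X f := ⟨fun m => mvfderiv 𝓘(ℝ, E) f m (X m), X.contMDiff_mvfderiv_apply f.contMDiff⟩

theorem lie_function_apply (X : SmoothVectorField E M) (f : C^∞⟮𝓘(ℝ, E), M; ℝ⟯) (m : M) :
    ⁅X, f⁆ m = mvfderiv 𝓘(ℝ, E) f m (X m) := rfl

theorem lie_function_apply_eq_zero {X : SmoothVectorField E M} {m : M} (hX : X m = 0)
    (f : C^∞⟮𝓘(ℝ, E), M; ℝ⟯) : ⁅X, f⁆ m = 0 := by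
  rw [lie_function_apply, hX, map_zero]

theorem lie_mul_function (X : SmoothVectorField E M) (f g : C^∞⟮𝓘(ℝ, E), M; ℝ⟯) :
    ⁅X, f * g⁆ = f * ⁅X, g⁆ + ⁅X, f⁆ * g := by
  ext m
  have h := mvfderiv_mul (I := 𝓘(ℝ, E)) (f.mdifferentiable m) (g.mdifferentiable m)
  refine (DFunLike.congr_fun h (X m)).trans ?_
  change _ = f m * ⁅X, g⁆ m + ⁅X, f⁆ m * g m
  simp [lie_function_apply, mul_comm]

variable [FiniteDimensional ℝ E]

theorem lie_smul_function (X : SmoothVectorField E M) (f : C^∞⟮𝓘(ℝ, E), M; ℝ⟯)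
    (Y : SmoothVectorField E M) : ⁅X, f • Y⁆ = f • ⁅X, Y⁆ + ⁅X, f⁆ • Y := by
  ext m
  exact (VectorField.mlieBracket_smul_right (V := X) (f.mdifferentiable m)
    Y.mdifferentiableAt).trans (add_comm _ _)

theorem lie_apply_eq_zero {X Y : SmoothVectorField E M} {m : M} (hX : X m = 0) (hY : Y m = 0) :
    ⁅X, Y⁆ m = 0 := by
  rw [lie_apply, ← VectorField.mlieBracketWithin_univ]
  exact VectorField.mlieBracketWithin_eq_zero_of_eq_zero hX hY

theorem sub_lie_lie_function_smul_eq_zero (X Y : SmoothVectorField E M)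
    (f : C^∞⟮𝓘(ℝ, E), M; ℝ⟯) (Z : SmoothVectorField E M) :
    (⁅X, ⁅Y, f⁆⁆ - ⁅⁅X, Y⁆, f⁆ - ⁅Y, ⁅X, f⁆⁆) • Z = 0 := by
  have hjacobi := leibniz_lie X Y (f • Z)
  simp only [lie_smul_function, lie_add, leibniz_lie X Y Z, smul_add] at hjacobi
  rw [sub_smul, sub_smul, ← sub_eq_zero.2 hjacobi]
  abel

/-- The Jacobi identity for `X`, `Y`, `f • Z` shows that the difference of the two sides kills every
vector field `Z`, in particular `X` and `Y`; at a common zero of `X` and `Y` both sides vanish. -/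
theorem leibniz_lie_function (X Y : SmoothVectorField E M) (f : C^∞⟮𝓘(ℝ, E), M; ℝ⟯) :
    ⁅X, ⁅Y, f⁆⁆ = ⁅⁅X, Y⁆, f⁆ + ⁅Y, ⁅X, f⁆⁆ := by
  ext m
  have hzero (Z : SmoothVectorField E M) (hZ : Z m ≠ 0) :
      ⁅X, ⁅Y, f⁆⁆ m = (⁅⁅X, Y⁆, f⁆ + ⁅Y, ⁅X, f⁆⁆) m := by
    have hsmul := (smul_eq_zero.1 (DFunLike.congr_fun
      (sub_lie_lie_function_smul_eq_zero X Y f Z) m)).resolve_right hZ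
    rw [sub_sub] at hsmul
    exact sub_eq_zero.1 hsmul
  by_cases hX : X m = 0
  · by_cases hY : Y m = 0
    · rw [ContMDiffMap.coe_add, Pi.add_apply, lie_function_apply_eq_zero hX,
        lie_function_apply_eq_zero hY, lie_function_apply_eq_zero (lie_apply_eq_zero hX hY),
        add_zero]
    · exact hzero Y hY
  · exact hzero X hX

instance : LieRingModule (SmoothVectorField E M) C^∞⟮𝓘(ℝ, E), M; ℝ⟯ where
  add_lie X Y f := by
    ext m
    exact map_add (mvfderiv 𝓘(ℝ, E) f m) _ _
  lie_add X f g := by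
    ext m
    exact DFunLike.congr_fun (mvfderiv_add (f.mdifferentiable m) (g.mdifferentiable m)) (X m)
  leibniz_lie := leibniz_lie_function

instance : LieRinehartRing C^∞⟮𝓘(ℝ, E), M; ℝ⟯ (SmoothVectorField E M) where
  lie_smul_eq_mul' f g X := by
    ext m
    exact map_smul (mvfderiv 𝓘(ℝ, E) g m) _ _
  leibniz_mul_right' := lie_mul_function
  leibniz_smul_right' X Y f := lie_smul_function X f Y

instance : LieModule ℝ (SmoothVectorField E M) C^∞⟮𝓘(ℝ, E), M; ℝ⟯ where
  smul_lie c X f := by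
    ext m
    exact map_smul (mvfderiv 𝓘(ℝ, E) f m) _ _
  lie_smul c X f := by
    ext m
    have h := mvfderiv_smul (mdifferentiableAt_const (I := 𝓘(ℝ, E)) (c := c))
      (f.mdifferentiable m)
    rw [mvfderiv_const] at h
    refine (DFunLike.congr_fun h (X m)).trans ?_
    change c * _ + 0 * _ = c * _
    rw [zero_mul, add_zero]
    rfl

end SmoothVectorField

namespace SmoothPrincipalBundle

variable {EM EG EP : Type*} [NormedAddCommGroup EM] [NormedSpace ℝ EM] [FiniteDimensional ℝ EM]
  [NormedAddCommGroup EG] [NormedSpace ℝ EG]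
  [NormedAddCommGroup EP] [NormedSpace ℝ EP] [FiniteDimensional ℝ EP]
  {M G P : Type*} [TopologicalSpace M] [ChartedSpace EM M] [IsManifold 𝓘(ℝ, EM) ∞ M]
  [TopologicalSpace G] [ChartedSpace EG G] [Group G]
  [TopologicalSpace P] [ChartedSpace EP P] [IsManifold 𝓘(ℝ, EP) ∞ P]
  (B : SmoothPrincipalBundle EM EG EP M G P)

theorem atiyahAlgebra_ext {X Y : B.atiyahAlgebra} (h : ∀ u, X.1 u = Y.1 u) : X = Y :=
  Subtype.ext (ContMDiffSection.ext h)

instance : SMul C^∞⟮𝓘(ℝ, EM), M; ℝ⟯ B.atiyahAlgebra where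
  smul f X := ⟨(f.comp ⟨B.proj, B.contMDiff_proj⟩ : C^∞⟮𝓘(ℝ, EP), P; ℝ⟯) • X.1, fun g u => by
    have h := congrArg (f (B.proj u) • ·) (X.2 g u)
    refine (map_smul _ _ _).trans (h.trans ?_)
    change f (B.proj u) • X.1 (B.act u g) = f (B.proj (B.act u g)) • X.1 (B.act u g)
    rw [B.proj_act]⟩

theorem smul_apply (f : C^∞⟮𝓘(ℝ, EM), M; ℝ⟯) (X : B.atiyahAlgebra) (u : P) :
    (f • X).1 u = f (B.proj u) • X.1 u := rfl

instance : Module C^∞⟮𝓘(ℝ, EM), M; ℝ⟯ B.atiyahAlgebra where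
  one_smul _ := B.atiyahAlgebra_ext fun _ => one_smul ℝ _
  mul_smul f _ _ := B.atiyahAlgebra_ext fun _ => mul_smul (f _) _ _
  smul_zero f := B.atiyahAlgebra_ext fun u => smul_zero (f (B.proj u))
  smul_add f _ _ := B.atiyahAlgebra_ext fun u => smul_add (f (B.proj u)) _ _
  add_smul f _ _ := B.atiyahAlgebra_ext fun u => add_smul (f (B.proj u)) _ _
  zero_smul _ := B.atiyahAlgebra_ext fun _ => zero_smul ℝ _

theorem anchor_smul (f : C^∞⟮𝓘(ℝ, EM), M; ℝ⟯) (X : B.atiyahAlgebra) :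
    B.anchor (f • X) = f • B.anchor X := by
  ext m
  obtain ⟨u, rfl⟩ := B.proj_surjective m
  rw [SmoothVectorField.smul_apply, B.anchor_proj, B.anchor_proj]
  exact map_smul _ _ _

instance : LieRingModule B.atiyahAlgebra C^∞⟮𝓘(ℝ, EM), M; ℝ⟯ := .compLieHom _ B.anchor

theorem lie_function_eq (X : B.atiyahAlgebra) (f : C^∞⟮𝓘(ℝ, EM), M; ℝ⟯) :
    ⁅X, f⁆ = ⁅B.anchor X, f⁆ := rfl

theorem lie_function_apply (X : B.atiyahAlgebra) (f : C^∞⟮𝓘(ℝ, EM), M; ℝ⟯) (m : M) :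
    ⁅X, f⁆ m = mvfderiv 𝓘(ℝ, EM) f m (B.anchor X m) := rfl

theorem lie_comp_proj (X : B.atiyahAlgebra) (f : C^∞⟮𝓘(ℝ, EM), M; ℝ⟯) :
    ⁅X.1, (f.comp ⟨B.proj, B.contMDiff_proj⟩ : C^∞⟮𝓘(ℝ, EP), P; ℝ⟯)⁆
      = (⁅X, f⁆ : C^∞⟮𝓘(ℝ, EM), M; ℝ⟯).comp ⟨B.proj, B.contMDiff_proj⟩ := by
  ext u
  have h := mfderiv_comp (I := 𝓘(ℝ, EP)) (I' := 𝓘(ℝ, EM)) (I'' := 𝓘(ℝ, ℝ)) u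
    (f.contMDiff.mdifferentiableAt (by simp)) (B.contMDiff_proj.mdifferentiableAt (by simp))
  refine (DFunLike.congr_fun h (X.1 u)).trans ?_
  change _ = mvfderiv 𝓘(ℝ, EM) f (B.proj u) (B.anchor X (B.proj u))
  rw [anchor_proj]
  rfl

instance : LieRinehartRing C^∞⟮𝓘(ℝ, EM), M; ℝ⟯ B.atiyahAlgebra where
  lie_smul_eq_mul' f g X := by
    rw [lie_function_eq, anchor_smul, LieRinehartRing.lie_smul_eq_mul, lie_function_eq]
  leibniz_mul_right' X f g := LieRinehartRing.leibniz_mul_right (B.anchor X) f g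
  leibniz_smul_right' X Y f := Subtype.ext <| by
    refine (SmoothVectorField.lie_smul_function X.1 _ Y.1).trans ?_
    rw [lie_comp_proj]
    rfl

instance : LieRinehartAlgebra ℝ C^∞⟮𝓘(ℝ, EM), M; ℝ⟯ B.atiyahAlgebra where
  smul_assoc c f X := B.atiyahAlgebra_ext fun u => smul_assoc c (f (B.proj u)) (X.1 u)
  __ := LieModule.compLieHom C^∞⟮𝓘(ℝ, EM), M; ℝ⟯ B.anchor

theorem lie_function_eq_zero {X : B.atiyahAlgebra} (hX : X ∈ B.kernelAlgebra)
    (f : C^∞⟮𝓘(ℝ, EM), M; ℝ⟯) : ⁅X, f⁆ = 0 := by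
  rw [lie_function_eq, (B.anchor.mem_ker).1 hX, zero_lie]

theorem smul_mem_kernelAlgebra (f : C^∞⟮𝓘(ℝ, EM), M; ℝ⟯) {X : B.atiyahAlgebra}
    (hX : X ∈ B.kernelAlgebra) : f • X ∈ B.kernelAlgebra := by
  rw [LieHom.mem_ker] at hX ⊢
  rw [anchor_smul, hX, smul_zero]

instance : SMul C^∞⟮𝓘(ℝ, EM), M; ℝ⟯ B.kernelAlgebra where
  smul f k := ⟨f • k.1, B.smul_mem_kernelAlgebra f k.2⟩

instance : Module C^∞⟮𝓘(ℝ, EM), M; ℝ⟯ B.kernelAlgebra where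
  one_smul _ := Subtype.ext (one_smul _ _)
  mul_smul _ _ _ := Subtype.ext (mul_smul _ _ _)
  smul_zero _ := Subtype.ext (smul_zero _)
  smul_add _ _ _ := Subtype.ext (smul_add _ _ _)
  add_smul _ _ _ := Subtype.ext (add_smul _ _ _)
  zero_smul _ := Subtype.ext (zero_smul _ _)

instance : IsScalarTower ℝ C^∞⟮𝓘(ℝ, EM), M; ℝ⟯ B.kernelAlgebra where
  smul_assoc c f k := Subtype.ext (smul_assoc c f k.1)

instance : IsLieRinehartModule C^∞⟮𝓘(ℝ, EM), M; ℝ⟯ B.atiyahAlgebra B.kernelAlgebra where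
  lie_smul_right X f k := Subtype.ext (LieRinehartRing.leibniz_smul_right X k.1 f)
  smul_lie_left f X k := Subtype.ext <| by
    refine (smul_lie_eq_sub f X k.1).trans ?_
    rw [B.lie_function_eq_zero k.2, zero_smul, sub_zero]
    rfl

instance : LieAlgebra C^∞⟮𝓘(ℝ, EM), M; ℝ⟯ B.kernelAlgebra where
  lie_smul f k l := Subtype.ext <| by
    refine (LieRinehartRing.leibniz_smul_right k.1 l.1 f).trans ?_
    rw [B.lie_function_eq_zero k.2, zero_smul, add_zero]
    rfl

end SmoothPrincipalBundle

end VectorFields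

noncomputable section SmoothFunctions

variable {E : Type*} [NormedAddCommGroup E] [NormedSpace ℝ E]
  {M : Type*} [TopologicalSpace M] [ChartedSpace E M]

/-- Evaluation at `x`, as a character of the algebra `C^∞(M)`. -/
def evalSmooth (x : M) : C^∞⟮𝓘(ℝ, E), M; ℝ⟯ →ₐ[ℝ] ℝ :=
  (Pi.evalAlgHom ℝ (fun _ : M => ℝ) x).comp ContMDiffMap.coeFnAlgHom

theorem evalSmooth_apply (x : M) (f : C^∞⟮𝓘(ℝ, E), M; ℝ⟯) : evalSmooth x f = f x := rfl

theorem aeval_smooth_apply (p : ℝ[X]) (f : C^∞⟮𝓘(ℝ, E), M; ℝ⟯) (x : M) :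
    aeval f p x = p.eval (f x) := by
  rw [← evalSmooth_apply, ← Polynomial.aeval_algHom_apply, evalSmooth_apply,
    Polynomial.coe_aeval_eq_eval]

theorem isUnit_smooth_of_forall_ne_zero {f : C^∞⟮𝓘(ℝ, E), M; ℝ⟯} (hf : ∀ x, f x ≠ 0) :
    IsUnit f := by
  refine IsUnit.of_mul_eq_one ⟨fun x => (f x)⁻¹, f.contMDiff.inv₀ hf⟩ ?_
  ext x
  exact mul_inv_cancel₀ (hf x)

theorem exists_mem_nonneg_pos_on_isCompact (J : Ideal C^∞⟮𝓘(ℝ, E), M; ℝ⟯) {C : Set M}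
    (hC : IsCompact C) (hJC : ∀ x ∈ C, ∃ f ∈ J, f x ≠ 0) :
    ∃ u ∈ J, (∀ x, 0 ≤ u x) ∧ ∀ x ∈ C, 0 < u x := by
  refine hC.induction_on (p := fun S => ∃ u ∈ J, (∀ x, 0 ≤ u x) ∧ ∀ x ∈ S, 0 < u x)
    ⟨0, J.zero_mem, fun _ => le_rfl, by simp⟩ ?_ ?_ ?_
  · rintro _ _ hSS' ⟨u, hu, hnonneg, hpos⟩
    exact ⟨u, hu, hnonneg, fun x hx => hpos x (hSS' hx)⟩
  · rintro S S' ⟨u, hu, hnonneg, hpos⟩ ⟨u', hu', hnonneg', hpos'⟩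
    refine ⟨u + u', J.add_mem hu hu', fun x => add_nonneg (hnonneg x) (hnonneg' x), ?_⟩
    rintro x (hx | hx)
    · exact add_pos_of_pos_of_nonneg (hpos x hx) (hnonneg' x)
    · exact add_pos_of_nonneg_of_pos (hnonneg x) (hpos' x hx)
  · intro x hx
    obtain ⟨f, hf, hfx⟩ := hJC x hx
    exact ⟨{y | f y ≠ 0}, mem_nhdsWithin_of_mem_nhds
      (f.contMDiff.continuous.continuousAt.eventually_ne hfx), f * f, J.mul_mem_left _ hf,
      fun y => mul_self_nonneg (f y), fun y hy => mul_self_pos.2 hy⟩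

variable [FiniteDimensional ℝ E] [IsManifold 𝓘(ℝ, E) ∞ M] [T2Space M] [SigmaCompactSpace M]

theorem exists_smooth_isCompact_sublevel :
    ∃ ρ : C^∞⟮𝓘(ℝ, E), M; ℝ⟯, ∀ c : ℝ, IsCompact {x | ρ x ≤ c} := by
  have : LocallyCompactSpace M := ChartedSpace.locallyCompactSpace E M
  let K : CompactExhaustion M := default
  obtain ⟨ρ, hρ⟩ := exists_contMDiffMap_forall_mem_convex_of_local_const (n := ⊤) 𝓘(ℝ, E)
    (t := fun x => Set.Ici (K.find x : ℝ)) (fun x => convex_Ici _) fun x => by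
      refine ⟨K.find x + 1, ?_⟩
      filter_upwards [mem_interior_iff_mem_nhds.1
        (K.subset_interior_succ (K.find x) (K.mem_find x))] with y hy
      change (K.find y : ℝ) ≤ (K.find x + 1 : ℝ)
      exact_mod_cast K.mem_iff_find_le.1 hy
  refine ⟨ρ, fun c => (K.isCompact ⌈c⌉₊).of_isClosed_subset
    (isClosed_le ρ.contMDiff.continuous continuous_const) fun x hx => ?_⟩
  have hle : (K.find x : ℝ) ≤ c := (hρ x).trans hx
  rw [K.mem_iff_find_le]
  exact_mod_cast hle.trans (Nat.le_ceil c)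

variable {J : Ideal C^∞⟮𝓘(ℝ, E), M; ℝ⟯} [Algebra.IsAlgebraic ℝ (C^∞⟮𝓘(ℝ, E), M; ℝ⟯ ⧸ J)]

/-- For a proper function `ρ` and `p ≠ 0` with `p(ρ) ∈ J`, the zero set of `p(ρ)` is compact, so
that finitely many elements of `J` are enough to be nonzero on it. -/
theorem exists_mem_isUnit_add_sq (s : C^∞⟮𝓘(ℝ, E), M; ℝ⟯)
    (hs : ∀ x, s x = 0 → ∃ f ∈ J, f x ≠ 0) : ∃ u ∈ J, IsUnit (u + s ^ 2) := by
  obtain ⟨ρ, hρ⟩ := exists_smooth_isCompact_sublevel (E := E) (M := M)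
  obtain ⟨p, hp, hpJ⟩ := isAlgebraic_quotient_iff.1 ‹_› ρ
  have hcompact : IsCompact {x | s x = 0 ∧ p.eval (ρ x) = 0} := by
    obtain ⟨c, hc⟩ := p.roots.toFinset.bddAbove
    refine (hρ c).of_isClosed_subset ?_ fun x hx => hc (by simpa [hp] using hx.2)
    exact (isClosed_eq s.contMDiff.continuous continuous_const).inter
      (isClosed_eq (p.continuous.comp ρ.contMDiff.continuous) continuous_const)
  obtain ⟨u, hu, hnonneg, hpos⟩ :=
    exists_mem_nonneg_pos_on_isCompact J hcompact fun x hx => hs x hx.1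
  refine ⟨u + aeval ρ p ^ 2, J.add_mem hu (J.pow_mem_of_mem hpJ 2 two_pos),
    isUnit_smooth_of_forall_ne_zero fun x => ne_of_gt ?_⟩
  have heval : (u + aeval ρ p ^ 2 + s ^ 2) x = u x + p.eval (ρ x) ^ 2 + s x ^ 2 := by
    rw [← aeval_smooth_apply]
    simp only [← evalSmooth_apply, map_add, map_pow]
  rw [heval]
  by_cases hsx : s x = 0
  · by_cases hpx : p.eval (ρ x) = 0
    · have := hpos x ⟨hsx, hpx⟩
      positivity
    · have := hnonneg x
      positivity
  · have := hnonneg x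
    positivity

theorem exists_forall_mem_eq_zero (hJ : J ≠ ⊤) : ∃ x, ∀ f ∈ J, f x = 0 := by
  by_contra! h
  obtain ⟨u, hu, hunit⟩ := exists_mem_isUnit_add_sq 0 fun x _ => h x
  rw [zero_pow two_ne_zero, add_zero] at hunit
  exact hJ (J.eq_top_of_isUnit_mem hu hunit)

theorem mem_of_mul_mem_of_unique_zero {m : M} (hm : ∀ x, (∀ f ∈ J, f x = 0) → x = m)
    {s f : C^∞⟮𝓘(ℝ, E), M; ℝ⟯} (hs : s m ≠ 0) (hsf : s * f ∈ J) : f ∈ J := by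
  obtain ⟨u, hu, hunit⟩ := exists_mem_isUnit_add_sq (J := J) s fun x hx => by
    by_contra! h
    exact hs (hm x h ▸ hx)
  rw [← Ideal.mul_unit_mem_iff_mem _ hunit, mul_add, pow_two, ← mul_assoc, mul_comm f s]
  exact J.add_mem (J.mul_mem_left _ hu) (J.mul_mem_right _ hsf)

theorem mem_radical_of_unique_zero {m : M} (hm : ∀ x, (∀ f ∈ J, f x = 0) → x = m)
    {f : C^∞⟮𝓘(ℝ, E), M; ℝ⟯} (hf : f m = 0) : f ∈ J.radical := by
  obtain ⟨p, hp, hpJ⟩ := isAlgebraic_quotient_iff.1 ‹_› f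
  obtain ⟨q, hpq, hq⟩ := Polynomial.exists_eq_pow_rootMultiplicity_mul_and_not_dvd p hp 0
  refine ⟨p.rootMultiplicity 0, mem_of_mul_mem_of_unique_zero hm (s := aeval f q) ?_ ?_⟩
  · rw [aeval_smooth_apply, hf]
    exact fun h => hq (Polynomial.dvd_iff_isRoot.2 h)
  · rw [hpq] at hpJ
    simpa [mul_comm] using hpJ

end SmoothFunctions

noncomputable section GenericAffinePerturbation

variable {E F : Type*} [NormedAddCommGroup E] [NormedSpace ℝ E] [NormedAddCommGroup F]
  [NormedSpace ℝ F]

theorem dense_compl_image_of_forall_contDiffAt [FiniteDimensional ℝ E] [FiniteDimensional ℝ F]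
    {f : E → F} {s : Set E} (hf : ∀ x ∈ s, ContDiffAt ℝ 1 f x)
    (hEF : Module.finrank ℝ E < Module.finrank ℝ F) : Dense (f '' s)ᶜ := by
  refine dense_compl_of_dimH_lt_finrank <|
    (dimH_image_le_of_locally_lipschitzOn fun x hx => ?_).trans_lt <|
    (dimH_mono (Set.subset_univ s)).trans_lt ?_
  · obtain ⟨K, t, ht, hK⟩ := (hf x hx).exists_lipschitzOnWith
    exact ⟨K, t, mem_nhdsWithin_of_mem_nhds ht, hK⟩
  · rw [Real.dimH_univ_eq_finrank]
    exact_mod_cast hEF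

variable (g : E → F) (φ : E → ℝ)

/-- The linear part `A` of an affine map `A + b` with value `c` at `x` for which `x` is a critical
point of `g + φ • (A + b)`, as a function of `(x, c)`; it is determined by `φ x • A + D g(x) +
D φ(x) ⊗ c = 0` when `φ x ≠ 0`. -/
def criticalLinearPart (p : E × F) : E →L[ℝ] F :=
  -(φ p.1)⁻¹ • (fderiv ℝ g p.1 + (fderiv ℝ φ p.1).smulRight p.2)

/-- The affine map `A + b` described in `criticalLinearPart`, encoded as the pair `(A, b)`. -/
def criticalAffineMap (p : E × F) : (E →L[ℝ] F) × F :=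
  (criticalLinearPart g φ p, p.2 - criticalLinearPart g φ p p.1)

variable {g φ}

theorem contDiffAt_criticalAffineMap {p : E × F} (hg : ContDiffAt ℝ ∞ g p.1)
    (hφ : ContDiffAt ℝ ∞ φ p.1) (hp : φ p.1 ≠ 0) : ContDiffAt ℝ 1 (criticalAffineMap g φ) p := by
  have hφfst : ContDiffAt ℝ 1 (fun p : E × F => φ p.1) p :=
    (hφ.of_le (by norm_cast)).comp p contDiffAt_fst
  have hDφ : ContDiffAt ℝ 1 (fun p : E × F => fderiv ℝ φ p.1) p :=
    (hφ.fderiv_right (m := 1) (by norm_cast)).comp p contDiffAt_fst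
  have hDg : ContDiffAt ℝ 1 (fun p : E × F => fderiv ℝ g p.1) p :=
    (hg.fderiv_right (m := 1) (by norm_cast)).comp p contDiffAt_fst
  have hA : ContDiffAt ℝ 1 (criticalLinearPart g φ) p :=
    (hφfst.inv hp).neg.smul (hDg.add (hDφ.smulRight contDiffAt_snd))
  exact hA.prodMk (contDiffAt_snd.sub (hA.clm_apply contDiffAt_fst))

theorem criticalAffineMap_eq_of_fderiv_eq_zero {A : E →L[ℝ] F} {b : F} {x : E}
    (hg : DifferentiableAt ℝ g x) (hφ : DifferentiableAt ℝ φ x) (hx : φ x ≠ 0)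
    (hcrit : fderiv ℝ (fun y => g y + φ y • (A y + b)) x = 0) :
    criticalAffineMap g φ (x, A x + b) = (A, b) := by
  have hderiv := (hg.hasFDerivAt.add
    (hφ.hasFDerivAt.smul (A.hasFDerivAt.add_const b))).fderiv.symm.trans hcrit
  have hA : criticalLinearPart g φ (x, A x + b) = A := by
    have hsum : fderiv ℝ g x + (fderiv ℝ φ x).smulRight (A x + b) = -(φ x • A) := by
      rw [eq_neg_iff_add_eq_zero, ← hderiv]
      abel
    rw [criticalLinearPart, hsum, smul_neg, neg_smul, neg_neg, inv_smul_smul₀ hx]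
  simp only [criticalAffineMap, hA, add_sub_cancel_left]

variable [FiniteDimensional ℝ E] [FiniteDimensional ℝ F]

theorem exists_affine_forall_fderiv_ne_zero (hE : 0 < Module.finrank ℝ E)
    (hF : 1 < Module.finrank ℝ F) {U : Set E} (hU : IsOpen U) (hg : ContDiffOn ℝ ∞ g U)
    (hφ : ContDiffOn ℝ ∞ φ U) :
    ∃ (A : E →L[ℝ] F) (b : F), ∀ x ∈ U, φ x ≠ 0 →
      fderiv ℝ (fun y => g y + φ y • (A y + b)) x ≠ 0 := by
  have hdim : Module.finrank ℝ (E × F) < Module.finrank ℝ ((E →L[ℝ] F) × F) := by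
    rw [Module.finrank_prod, Module.finrank_prod, ← LinearEquiv.finrank_eq
      (LinearMap.toContinuousLinearMap (𝕜 := ℝ) (E := E) (F' := F)), Module.finrank_linearMap]
    exact Nat.add_lt_add_right (lt_mul_of_one_lt_right hE hF) _
  obtain ⟨⟨A, b⟩, hAb⟩ := (dense_compl_image_of_forall_contDiffAt
    (s := {p : E × F | p.1 ∈ U ∧ φ p.1 ≠ 0}) (fun p hp => contDiffAt_criticalAffineMap
      (hg.contDiffAt (hU.mem_nhds hp.1)) (hφ.contDiffAt (hU.mem_nhds hp.1)) hp.2) hdim).nonempty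
  refine ⟨A, b, fun x hx hφx hcrit => hAb ⟨(x, A x + b), ⟨hx, hφx⟩, ?_⟩⟩
  exact criticalAffineMap_eq_of_fderiv_eq_zero
    ((hg.contDiffAt (hU.mem_nhds hx)).differentiableAt (by simp))
    ((hφ.contDiffAt (hU.mem_nhds hx)).differentiableAt (by simp)) hφx hcrit

end GenericAffinePerturbation

section NowhereCriticalMap

variable {E : Type*} [NormedAddCommGroup E] [NormedSpace ℝ E]
  {M : Type*} [TopologicalSpace M] [ChartedSpace E M]
  {F : Type*} [NormedAddCommGroup F] [NormedSpace ℝ F]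

theorem mvfderiv_add_smul_of_eq_zero {H k : M → F} {φ : M → ℝ} {x : M}
    (hH : MDifferentiableAt 𝓘(ℝ, E) 𝓘(ℝ, F) H x) (hφ : MDifferentiableAt 𝓘(ℝ, E) 𝓘(ℝ, ℝ) φ x)
    (hk : MDifferentiableAt 𝓘(ℝ, E) 𝓘(ℝ, F) k x) (hφx : φ x = 0) (hkx : k x = 0) :
    mvfderiv 𝓘(ℝ, E) (fun y => H y + φ y • k y) x = mvfderiv 𝓘(ℝ, E) H x := by
  refine (mvfderiv_add hH (hφ.smul hk)).trans ?_
  have hsmul := mvfderiv_smul hφ hk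
  rw [hφx, hkx, zero_smul, zero_add] at hsmul
  rw [hsmul]
  ext v
  simp

variable [IsManifold 𝓘(ℝ, E) ∞ M]

theorem fderiv_comp_extChartAt_symm_eq_zero {f : M → F} {x₀ x : M}
    (hx : x ∈ (chartAt E x₀).source) (hf : MDifferentiableAt 𝓘(ℝ, E) 𝓘(ℝ, F) f x)
    (hzero : mvfderiv 𝓘(ℝ, E) f x = 0) :
    fderiv ℝ (f ∘ (extChartAt 𝓘(ℝ, E) x₀).symm) (extChartAt 𝓘(ℝ, E) x₀ x) = 0 := by
  let e := extChartAt 𝓘(ℝ, E) x₀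
  have hxe : x ∈ e.source := by rwa [extChartAt_source]
  have hsymm : MDifferentiableAt 𝓘(ℝ, E) 𝓘(ℝ, E) e.symm (e x) :=
    ((contMDiffOn_extChartAt_symm (n := ∞) x₀).contMDiffAt ((isOpen_extChartAt_target x₀).mem_nhds
      (e.map_source hxe))).mdifferentiableAt (by simp)
  have hsymm_zero : mfderiv 𝓘(ℝ, E) 𝓘(ℝ, F) f (e.symm (e x)) = 0 := by
    rw [e.left_inv hxe]
    exact hzero
  rw [← mfderiv_eq_fderiv, mfderiv_comp_of_eq hf hsymm (e.left_inv hxe), hsymm_zero]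
  exact ContinuousLinearMap.zero_comp _

theorem contMDiff_smul_affine_extChartAt {φ : M → ℝ} (hφ : ContMDiff 𝓘(ℝ, E) 𝓘(ℝ, ℝ) ∞ φ) {x₀ : M}
    (hφs : tsupport φ ⊆ (chartAt E x₀).source) (A : E →L[ℝ] F) (b : F) :
    ContMDiff 𝓘(ℝ, E) 𝓘(ℝ, F) ∞ fun x => φ x • (A (extChartAt 𝓘(ℝ, E) x₀ x) + b) := by
  refine contMDiff_of_tsupport fun x hx => ?_
  have hchart := (contMDiffOn_extChartAt (I := 𝓘(ℝ, E)) (n := ∞)).contMDiffAt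
    ((chartAt E x₀).open_source.mem_nhds (hφs (tsupport_smul_subset_left _ _ hx)))
  exact hφ.contMDiffAt.smul (((A.contMDiff.contMDiffAt).comp x hchart).add contMDiffAt_const)

variable [FiniteDimensional ℝ E] [FiniteDimensional ℝ F]

/-- The perturbation is `φ² • (A + b)` for a generic affine map `A + b` in the chart: the square
leaves the differential unchanged where `φ` vanishes. -/
theorem exists_perturbation_mvfderiv_ne_zero (hE : 0 < Module.finrank ℝ E)
    (hF : 1 < Module.finrank ℝ F) {x₀ : M} (H : C^∞⟮𝓘(ℝ, E), M; 𝓘(ℝ, F), F⟯)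
    {φ : C^∞⟮𝓘(ℝ, E), M; ℝ⟯} (hφs : tsupport φ ⊆ (chartAt E x₀).source) :
    ∃ H' : C^∞⟮𝓘(ℝ, E), M; 𝓘(ℝ, F), F⟯, (∀ x, φ x = 0 → H' x = H x) ∧
      (∀ x, φ x = 0 → mvfderiv 𝓘(ℝ, E) H' x = mvfderiv 𝓘(ℝ, E) H x) ∧
      ∀ x, φ x ≠ 0 → mvfderiv 𝓘(ℝ, E) H' x ≠ 0 := by
  let e := extChartAt 𝓘(ℝ, E) x₀
  have htarget : IsOpen e.target := isOpen_extChartAt_target x₀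
  have hsymm : ContMDiffOn 𝓘(ℝ, E) 𝓘(ℝ, E) ∞ e.symm e.target := contMDiffOn_extChartAt_symm x₀
  obtain ⟨A, b, hAb⟩ := exists_affine_forall_fderiv_ne_zero hE hF htarget
    (H.contMDiff.comp_contMDiffOn hsymm).contDiffOn
    ((φ.contMDiff.mul φ.contMDiff).comp_contMDiffOn hsymm).contDiffOn
  let k : M → F := fun x => φ x • (A (e x) + b)
  have hk : ContMDiff 𝓘(ℝ, E) 𝓘(ℝ, F) ∞ k := contMDiff_smul_affine_extChartAt φ.contMDiff hφs A b
  let H' : C^∞⟮𝓘(ℝ, E), M; 𝓘(ℝ, F), F⟯ :=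
    ⟨fun x => H x + φ x • k x, H.contMDiff.add (φ.contMDiff.smul hk)⟩
  refine ⟨H', fun x hx => ?_, fun x hx => ?_, fun x hx hzero => ?_⟩
  · change H x + φ x • k x = H x
    rw [hx, zero_smul, add_zero]
  · exact mvfderiv_add_smul_of_eq_zero (H.mdifferentiable x) (φ.mdifferentiable x)
      (hk.mdifferentiableAt (by simp)) hx (by simp only [k, hx, zero_smul])
  · have hxs : x ∈ (chartAt E x₀).source := hφs (subset_tsupport _ hx)
    have hxe : x ∈ e.source := by rwa [extChartAt_source]
    refine hAb (e x) (e.map_source hxe) (by simpa [e.left_inv hxe] using hx) ?_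
    rw [← fderiv_comp_extChartAt_symm_eq_zero hxs (H'.mdifferentiable x) hzero]
    refine Filter.EventuallyEq.fderiv_eq ?_
    filter_upwards [htarget.mem_nhds (e.map_source hxe)] with y hy
    change _ = H (e.symm y) + φ (e.symm y) • φ (e.symm y) • (A (e (e.symm y)) + b)
    rw [e.right_inv hy, smul_smul]
    rfl

theorem exists_smoothPartitionOfUnity_subordinate_chartAt [Nonempty M] [T2Space M]
    [SecondCountableTopology M] :
    ∃ (c : ℕ → M) (φ : SmoothPartitionOfUnity ℕ 𝓘(ℝ, E) M),
      ∀ n, tsupport (φ n) ⊆ (chartAt E (c n)).source := by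
  have : LocallyCompactSpace M := ChartedSpace.locallyCompactSpace E M
  obtain ⟨s, hs, hsU⟩ := TopologicalSpace.countable_cover_nhds fun x : M =>
    (chartAt E x).open_source.mem_nhds (mem_chart_source E x)
  obtain ⟨x, hx, -⟩ := Set.mem_iUnion₂.1 (hsU.ge (Set.mem_univ (Classical.arbitrary M)))
  obtain ⟨c, rfl⟩ := hs.exists_eq_range ⟨x, hx⟩
  rw [Set.biUnion_range] at hsU
  obtain ⟨φ, hφ⟩ := SmoothPartitionOfUnity.exists_isSubordinate 𝓘(ℝ, E) isClosed_univ
    (fun n => (chartAt E (c n)).source) (fun n => (chartAt E (c n)).open_source) hsU.ge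
  exact ⟨c, φ, hφ⟩

theorem exists_forall_mvfderiv_ne_zero [T2Space M] [SecondCountableTopology M]
    (hE : 0 < Module.finrank ℝ E) (hF : 1 < Module.finrank ℝ F) :
    ∃ H : C^∞⟮𝓘(ℝ, E), M; 𝓘(ℝ, F), F⟯, ∀ x, mvfderiv 𝓘(ℝ, E) H x ≠ 0 := by
  rcases isEmpty_or_nonempty M with hM | hM
  · exact ⟨⟨fun _ => 0, contMDiff_const⟩, fun x => isEmptyElim x⟩
  obtain ⟨c, φ, hφ⟩ := exists_smoothPartitionOfUnity_subordinate_chartAt (E := E) (M := M)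
  choose next hnext_eq hnext_deriv_eq hnext_deriv_ne using
    fun n H => exists_perturbation_mvfderiv_ne_zero (F := F) hE hF H (hφ n)
  let H : ℕ → C^∞⟮𝓘(ℝ, E), M; 𝓘(ℝ, F), F⟯ := fun n => Nat.rec ⟨fun _ => 0, contMDiff_const⟩ next n
  have hlocfin : LocallyFinite fun n => {x | H (n + 1) x ≠ H n x} :=
    φ.locallyFinite.subset fun n x hx hφx => hx (hnext_eq n (H n) x hφx)
  obtain ⟨L, hL⟩ := hlocfin.exists_forall_eventually_atTop_eventuallyEq (f := fun n x => H n x)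
  have hLsmooth : ContMDiff 𝓘(ℝ, E) 𝓘(ℝ, F) ∞ L := fun x => by
    obtain ⟨n, hn⟩ := (hL x).exists
    exact (H n).contMDiff.contMDiffAt.congr_of_eventuallyEq hn.symm
  refine ⟨⟨L, hLsmooth⟩, fun x hzero => ?_⟩
  obtain ⟨j, hj⟩ := φ.exists_pos_of_mem (Set.mem_univ x)
  have hne : ∀ n, j + 1 ≤ n → mvfderiv 𝓘(ℝ, E) (H n) x ≠ 0 := fun n hn => by
    induction n, hn using Nat.le_induction with
    | base => exact hnext_deriv_ne j (H j) x hj.ne'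
    | succ n _ ih =>
      by_cases hφx : φ n x = 0
      · exact (hnext_deriv_eq n (H n) x hφx).trans_ne ih
      · exact hnext_deriv_ne n (H n) x hφx
  obtain ⟨n, hn, hjn⟩ := ((hL x).and (Filter.eventually_ge_atTop (j + 1))).exists
  exact hne n hjn (hn.mfderiv_eq.trans hzero)

theorem exists_pair_forall_mvfderiv_ne_zero [T2Space M] [SecondCountableTopology M]
    (hE : 0 < Module.finrank ℝ E) :
    ∃ h : Fin 2 → C^∞⟮𝓘(ℝ, E), M; ℝ⟯, ∀ x, ∃ i, mvfderiv 𝓘(ℝ, E) (h i) x ≠ 0 := by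
  obtain ⟨H, hH⟩ := exists_forall_mvfderiv_ne_zero (M := M) (F := Fin 2 → ℝ) hE (by simp)
  let h : Fin 2 → C^∞⟮𝓘(ℝ, E), M; ℝ⟯ := fun i =>
    ⟨_, (ContinuousLinearMap.proj (R := ℝ) (φ := fun _ : Fin 2 => ℝ) i).contMDiff.comp H.contMDiff⟩
  refine ⟨h, fun x => ?_⟩
  by_contra! hzero
  refine hH x (ContinuousLinearMap.ext fun v => funext fun i => ?_)
  let π := ContinuousLinearMap.proj (R := ℝ) (φ := fun _ : Fin 2 => ℝ) i
  have hcomp : mfderiv 𝓘(ℝ, E) 𝓘(ℝ, ℝ) (π ∘ H) x = _ :=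
    mfderiv_comp x (π.contMDiff.mdifferentiableAt (n := ∞) (by simp)) (H.mdifferentiable x)
  rw [mfderiv_eq_fderiv, π.fderiv] at hcomp
  exact congrArg (fun l => l v) (hcomp.symm.trans (hzero i))

end NowhereCriticalMap

section Semisimple

variable {g : Type*} [LieRing g] [LieAlgebra ℝ g]

theorem lie_self_eq_of_isSemisimple [LieAlgebra.IsSemisimple ℝ g] (I : LieIdeal ℝ g) :
    ⁅I, I⁆ = I := by
  have hle : ⁅I, I⁆ ≤ I := LieSubmodule.lie_le_left _ _
  have habelian : I ⊓ ⁅I, I⁆ᶜ = ⊥ := by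
    refine (LieAlgebra.hasTrivialRadical_iff_no_abelian_ideals ℝ g).1 inferInstance _ ?_
    rw [LieSubmodule.lie_abelian_iff_lie_self_eq_bot, eq_bot_iff]
    calc ⁅I ⊓ ⁅I, I⁆ᶜ, I ⊓ ⁅I, I⁆ᶜ⁆ ≤ ⁅I, I⁆ ⊓ ⁅I, I⁆ᶜ :=
          le_inf (LieSubmodule.mono_lie inf_le_left inf_le_left)
            ((LieSubmodule.lie_le_left _ _).trans inf_le_right)
      _ ≤ ⊥ := (inf_compl_self _).le
  exact le_antisymm hle (compl_compl ⁅I, I⁆ ▸ (disjoint_iff.2 habelian).le_compl_right)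

theorem exists_isCoatom_notMem_of_isSemisimple [LieAlgebra.IsSemisimple ℝ g] {x : g}
    (hx : x ≠ 0) : ∃ I : LieIdeal ℝ g, IsCoatom I ∧ x ∉ I := by
  by_contra! h
  have hcompl : (LieSubmodule.lieSpan ℝ g {x} : LieIdeal ℝ g)ᶜ = ⊤ := by
    rw [eq_top_iff, ← LieAlgebra.IsSemisimple.sSup_atoms_eq_top]
    refine sSup_le fun I hI => le_compl_comm.1 ?_
    rw [LieSubmodule.lieSpan_le, Set.singleton_subset_iff]
    exact h _ (isCoatom_compl.2 hI)
  rw [compl_eq_top, LieSubmodule.lieSpan_eq_bot_iff] at hcompl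
  exact hx (hcompl x rfl)

theorem isMaximalFiniteCodim_comap [FiniteDimensional ℝ g] {K : Type*} [LieRing K]
    [LieAlgebra ℝ K] {ev : K →ₗ⁅ℝ⁆ g} (hev : Function.Surjective ev) {I : LieIdeal ℝ g}
    (hI : IsCoatom I) : (I.comap ev).IsMaximalFiniteCodim := by
  refine ⟨fun htop => hI.1 ?_, ?_, fun J hJ _ hlt => hJ ?_⟩
  · rw [eq_top_iff]
    intro y _
    obtain ⟨k, rfl⟩ := hev y
    exact LieIdeal.mem_comap.1 (htop ▸ LieSubmodule.mem_top k)
  · exact cofg_comap (inferInstanceAs (Module.Finite ℝ (g ⧸ I.toSubmodule))) (ev : K →ₗ[ℝ] g)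
  · have hker : ev.ker ≤ J := fun k hk => hlt.le (LieIdeal.mem_comap.2 (by
      rw [(ev.mem_ker).1 hk]
      exact I.zero_mem))
    have hcomap : (J.map ev).comap ev = J := by
      have himage := congrArg (fun S : Submodule ℝ g => (S : Set g))
        (LieIdeal.coe_map_of_surjective (I := J) hev)
      rw [LieIdeal.comap_map_eq himage, sup_eq_left.2 hker]
    have hle : I ≤ J.map ev := fun y hy => by
      obtain ⟨k, rfl⟩ := hev y
      exact LieIdeal.mem_map (hlt.le (LieIdeal.mem_comap.2 hy))
    rcases hI.le_iff.1 hle with hmap | hmap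
    · rw [← hcomap, hmap, eq_top_iff]
      exact fun _ _ => LieIdeal.mem_comap.2 (LieSubmodule.mem_top _)
    · exact absurd (hmap ▸ hcomap) hlt.ne

end Semisimple

section PartialDerivatives

variable {E E' E'' EN : Type*} [NormedAddCommGroup E] [NormedSpace ℝ E]
  [NormedAddCommGroup E'] [NormedSpace ℝ E'] [NormedAddCommGroup E''] [NormedSpace ℝ E'']
  [NormedAddCommGroup EN] [NormedSpace ℝ EN]
  {M M' M'' N : Type*} [TopologicalSpace M] [ChartedSpace E M] [IsManifold 𝓘(ℝ, E) ∞ M]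
  [TopologicalSpace M'] [ChartedSpace E' M'] [IsManifold 𝓘(ℝ, E') ∞ M']
  [TopologicalSpace M''] [ChartedSpace E'' M''] [IsManifold 𝓘(ℝ, E'') ∞ M'']
  [TopologicalSpace N] [ChartedSpace EN N]
  {F : M × M' → M''} {s : Set N}

theorem contMDiffOn_mfderiv_add_mfderiv
    (hF : ContMDiff (𝓘(ℝ, E).prod 𝓘(ℝ, E')) 𝓘(ℝ, E'') ∞ F)
    {a : N → TangentBundle 𝓘(ℝ, E) M} (ha : ContMDiffOn 𝓘(ℝ, EN) 𝓘(ℝ, E).tangent ∞ a s)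
    {b : N → TangentBundle 𝓘(ℝ, E') M'} (hb : ContMDiffOn 𝓘(ℝ, EN) 𝓘(ℝ, E').tangent ∞ b s) :
    ContMDiffOn 𝓘(ℝ, EN) 𝓘(ℝ, E'').tangent ∞
      (fun n => (⟨F ((a n).1, (b n).1),
        (mfderiv 𝓘(ℝ, E) 𝓘(ℝ, E'') (fun z => F (z, (b n).1)) (a n).1 (a n).2 : E'') +
        (mfderiv 𝓘(ℝ, E') 𝓘(ℝ, E'') (fun z => F ((a n).1, z)) (b n).1 (b n).2 : E'')⟩ :
        TangentBundle 𝓘(ℝ, E'') M'')) s := by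
  have htangent : ContMDiff (𝓘(ℝ, E).prod 𝓘(ℝ, E')).tangent 𝓘(ℝ, E'').tangent ∞
      (tangentMap (𝓘(ℝ, E).prod 𝓘(ℝ, E')) 𝓘(ℝ, E'') F) := hF.contMDiff_tangentMap (by rfl)
  refine ((htangent.comp (contMDiff_equivTangentBundleProd_symm (I := 𝓘(ℝ, E)) (M := M)
    (I' := 𝓘(ℝ, E')) (M' := M'))).comp_contMDiffOn (ha.prodMk hb)).congr fun n _ => ?_
  let v : TangentSpace (𝓘(ℝ, E).prod 𝓘(ℝ, E')) ((a n).1, (b n).1) := ((a n).2, (b n).2)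
  have hadd := mfderiv_prod_eq_add_apply (v := v) (hF.mdifferentiableAt (by simp))
  exact congrArg (Bundle.TotalSpace.mk (F ((a n).1, (b n).1))) hadd.symm

theorem contMDiffOn_mfderiv_left (hF : ContMDiff (𝓘(ℝ, E).prod 𝓘(ℝ, E')) 𝓘(ℝ, E'') ∞ F)
    {a : N → TangentBundle 𝓘(ℝ, E) M} (ha : ContMDiffOn 𝓘(ℝ, EN) 𝓘(ℝ, E).tangent ∞ a s)
    {y : N → M'} (hy : ContMDiffOn 𝓘(ℝ, EN) 𝓘(ℝ, E') ∞ y s) :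
    ContMDiffOn 𝓘(ℝ, EN) 𝓘(ℝ, E'').tangent ∞
      (fun n => (⟨F ((a n).1, y n),
        mfderiv 𝓘(ℝ, E) 𝓘(ℝ, E'') (fun z => F (z, y n)) (a n).1 (a n).2⟩ :
        TangentBundle 𝓘(ℝ, E'') M'')) s := by
  have hzero : ContMDiffOn 𝓘(ℝ, EN) 𝓘(ℝ, E').tangent ∞
      (fun n => (⟨y n, 0⟩ : TangentBundle 𝓘(ℝ, E') M')) s :=
    (Bundle.contMDiff_zeroSection ℝ (TangentSpace 𝓘(ℝ, E') : M' → Type _)).comp_contMDiffOn hy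
  refine (contMDiffOn_mfderiv_add_mfderiv hF ha hzero).congr fun n _ => ?_
  refine congrArg (Bundle.TotalSpace.mk (F ((a n).1, y n))) (Eq.trans ?_ (congrArg (_ + ·)
    (map_zero (mfderiv 𝓘(ℝ, E') 𝓘(ℝ, E'') (fun z => F ((a n).1, z)) (y n)))).symm)
  exact (add_zero _).symm

theorem contMDiffOn_mfderiv_right (hF : ContMDiff (𝓘(ℝ, E).prod 𝓘(ℝ, E')) 𝓘(ℝ, E'') ∞ F)
    {x : N → M} (hx : ContMDiffOn 𝓘(ℝ, EN) 𝓘(ℝ, E) ∞ x s)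
    {b : N → TangentBundle 𝓘(ℝ, E') M'} (hb : ContMDiffOn 𝓘(ℝ, EN) 𝓘(ℝ, E').tangent ∞ b s) :
    ContMDiffOn 𝓘(ℝ, EN) 𝓘(ℝ, E'').tangent ∞
      (fun n => (⟨F (x n, (b n).1),
        mfderiv 𝓘(ℝ, E') 𝓘(ℝ, E'') (fun z => F (x n, z)) (b n).1 (b n).2⟩ :
        TangentBundle 𝓘(ℝ, E'') M'')) s := by
  have hzero : ContMDiffOn 𝓘(ℝ, EN) 𝓘(ℝ, E).tangent ∞
      (fun n => (⟨x n, 0⟩ : TangentBundle 𝓘(ℝ, E) M)) s :=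
    (Bundle.contMDiff_zeroSection ℝ (TangentSpace 𝓘(ℝ, E) : M → Type _)).comp_contMDiffOn hx
  refine (contMDiffOn_mfderiv_add_mfderiv hF hzero hb).congr fun n _ => ?_
  refine congrArg (Bundle.TotalSpace.mk (F (x n, (b n).1))) (Eq.trans ?_ (congrArg (· + _)
    (map_zero (mfderiv 𝓘(ℝ, E) 𝓘(ℝ, E'') (fun z => F (z, (b n).1)) (x n)))).symm)
  exact (zero_add _).symm

end PartialDerivatives

noncomputable section LeftInvariant

variable {EG : Type*} [NormedAddCommGroup EG] [NormedSpace ℝ EG]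
  {G : Type*} [TopologicalSpace G] [ChartedSpace EG G] [Group G] [LieGroup 𝓘(ℝ, EG) ∞ G]

/-- The left-invariant vector field with value `ξ` at `1`. It is Mathlib's `mulInvariantVectorField`
bundled as a `C^∞` section of the tangent bundle. -/
def leftInvariantField (ξ : GroupLieAlgebra 𝓘(ℝ, EG) G) : SmoothVectorField EG G :=
  ⟨mulInvariantVectorField ξ, contMDiffOn_univ.1 <| by
    have hconst : ContMDiffOn 𝓘(ℝ, EG) 𝓘(ℝ, EG).tangent ∞
        (fun _ : G => (⟨1, ξ⟩ : TangentBundle 𝓘(ℝ, EG) G)) Set.univ := contMDiffOn_const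
    exact (contMDiffOn_mfderiv_right (contMDiff_mul 𝓘(ℝ, EG) ∞) contMDiffOn_id hconst).congr
      fun g _ => Bundle.TotalSpace.ext (mul_one g).symm HEq.rfl⟩

end LeftInvariant

section SmoothExtension

variable {E : Type*} [NormedAddCommGroup E] [NormedSpace ℝ E]
  {M : Type*} [TopologicalSpace M] [ChartedSpace E M]

theorem exists_smooth_eq_mul {U : Set M} (hU : IsOpen U) {χ : C^∞⟮𝓘(ℝ, E), M; ℝ⟯}
    (hχ : tsupport χ ⊆ U) {F : M → ℝ} (hF : ContMDiffOn 𝓘(ℝ, E) 𝓘(ℝ, ℝ) ∞ F U) :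
    ∃ c : C^∞⟮𝓘(ℝ, E), M; ℝ⟯, ∀ x, c x = χ x * F x :=
  ⟨⟨fun x => χ x * F x, contMDiff_of_tsupport fun x hx => (χ.contMDiff x).mul
    (hF.contMDiffAt (hU.mem_nhds (hχ (tsupport_mul_subset_left hx))))⟩, fun _ => rfl⟩

variable [IsManifold 𝓘(ℝ, E) ∞ M]

theorem contMDiffOn_mfderiv_of_isOpen {E' EN : Type*} [NormedAddCommGroup E'] [NormedSpace ℝ E']
    [NormedAddCommGroup EN] [NormedSpace ℝ EN]
    {M' N : Type*} [TopologicalSpace M'] [ChartedSpace E' M'] [IsManifold 𝓘(ℝ, E') ∞ M']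
    [TopologicalSpace N] [ChartedSpace EN N] {f : M → M'} {U : Set M} (hU : IsOpen U)
    (hf : ContMDiffOn 𝓘(ℝ, E) 𝓘(ℝ, E') ∞ f U) {a : N → TangentBundle 𝓘(ℝ, E) M} {s : Set N}
    (ha : ContMDiffOn 𝓘(ℝ, EN) 𝓘(ℝ, E).tangent ∞ a s) (hs : ∀ n ∈ s, (a n).1 ∈ U) :
    ContMDiffOn 𝓘(ℝ, EN) 𝓘(ℝ, E').tangent ∞
      (fun n => (⟨f (a n).1, mfderiv 𝓘(ℝ, E) 𝓘(ℝ, E') f (a n).1 (a n).2⟩ :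
        TangentBundle 𝓘(ℝ, E') M')) s := by
  refine ((hf.contMDiffOn_tangentMapWithin (by rfl) hU.uniqueMDiffOn).comp ha hs).congr
    fun n hn => ?_
  rw [← mfderivWithin_of_isOpen hU (hs n hn)]
  rfl

variable [FiniteDimensional ℝ E] [T2Space M]

theorem exists_smooth_eventuallyEq_one {V : Set M} {m : M} (hV : V ∈ 𝓝 m) :
    ∃ f : C^∞⟮𝓘(ℝ, E), M; ℝ⟯, f =ᶠ[𝓝 m] 1 ∧ tsupport f ⊆ V := by
  obtain ⟨f, -, hf⟩ := (SmoothBumpFunction.nhds_basis_tsupport (I := 𝓘(ℝ, E)) m).mem_iff.1 hV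
  exact ⟨⟨f, f.contMDiff⟩, f.eventuallyEq_one, hf⟩

theorem exists_smooth_eventuallyEq {U : Set M} (hU : IsOpen U) {F : M → ℝ}
    (hF : ContMDiffOn 𝓘(ℝ, E) 𝓘(ℝ, ℝ) ∞ F U) {m : M} (hm : m ∈ U) :
    ∃ c : C^∞⟮𝓘(ℝ, E), M; ℝ⟯, c =ᶠ[𝓝 m] F := by
  obtain ⟨χ, hχone, hχ⟩ := exists_smooth_eventuallyEq_one (E := E) (hU.mem_nhds hm)
  obtain ⟨c, hc⟩ := exists_smooth_eq_mul hU hχ hF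
  refine ⟨c, ?_⟩
  filter_upwards [hχone] with x hx
  rw [hc, hx, Pi.one_apply, one_mul]

theorem exists_smooth_mvfderiv_eq_one {m : M} {v : TangentSpace 𝓘(ℝ, E) m} (hv : v ≠ 0) :
    ∃ c : C^∞⟮𝓘(ℝ, E), M; ℝ⟯, c m = 0 ∧ mvfderiv 𝓘(ℝ, E) c m v = 1 := by
  let φ := extChartAt 𝓘(ℝ, E) m
  have hm : m ∈ φ.source := mem_extChartAt_source m
  have hsource : IsOpen φ.source := isOpen_extChartAt_source m
  have hφ : ContMDiffOn 𝓘(ℝ, E) 𝓘(ℝ, E) ∞ φ φ.source := by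
    simpa only [φ, extChartAt_source] using contMDiffOn_extChartAt (I := 𝓘(ℝ, E)) (x := m) (n := ∞)
  have hne : mfderiv 𝓘(ℝ, E) 𝓘(ℝ, E) φ m v ≠ 0 := fun h => hv
    ((isInvertible_mfderiv_extChartAt hm).injective (h.trans (map_zero _).symm))
  obtain ⟨l, hl⟩ : ∃ l : E →L[ℝ] ℝ, l (mfderiv 𝓘(ℝ, E) 𝓘(ℝ, E) φ m v) = 1 :=
    SeparatingDual.exists_eq_one (R := ℝ) (V := E) hne
  have hg : HasFDerivAt (fun y => l (y - φ m)) l (φ m) :=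
    l.hasFDerivAt.comp (φ m) ((hasFDerivAt_id (φ m)).sub_const (φ m))
  obtain ⟨c, hc⟩ := exists_smooth_eventuallyEq hsource
    ((l.contDiff.comp (contDiff_id.sub contDiff_const)).contMDiff.comp_contMDiffOn hφ) hm
  refine ⟨c, hc.self_of_nhds.trans ((congrArg l (sub_self (φ m))).trans (map_zero l)), ?_⟩
  have hφm := ((hφ.contMDiffAt (hsource.mem_nhds hm)).mdifferentiableAt (by simp)).hasMFDerivAt
  exact (congrArg (fun l => l v)
    ((hg.hasMFDerivAt.comp m hφm).congr_of_eventuallyEq hc).mfderiv).trans hl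

theorem exists_smoothVectorField_apply_eq {m : M} (w : TangentSpace 𝓘(ℝ, E) m) :
    ∃ X : SmoothVectorField E M, X m = w := by
  obtain ⟨s, hs, hw⟩ := FiberBundle.exists_contMDiffOn_extend (k := ∞) 𝓘(ℝ, E) E w
  obtain ⟨t, hts, ht, hmt⟩ := mem_nhds_iff.1 hs
  obtain ⟨f, hfone, hf⟩ := exists_smooth_eventuallyEq_one (E := E) (ht.mem_nhds hmt)
  refine ⟨⟨fun x => f x • FiberBundle.extend E w x,
    ContMDiffOn.smul_section_of_tsupport f.contMDiff.contMDiffOn ht hf (hw.mono hts)⟩, ?_⟩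
  change f m • FiberBundle.extend E w m = w
  rw [hfone.self_of_nhds, Pi.one_apply, one_smul, FiberBundle.extend_apply_self]

end SmoothExtension

noncomputable section LocalSections

namespace SmoothPrincipalBundle

variable {EM EG EP : Type*} [NormedAddCommGroup EM] [NormedSpace ℝ EM]
  [NormedAddCommGroup EG] [NormedSpace ℝ EG]
  [NormedAddCommGroup EP] [NormedSpace ℝ EP]
  {M G P : Type*} [TopologicalSpace M] [ChartedSpace EM M]
  [TopologicalSpace G] [ChartedSpace EG G] [Group G]
  [TopologicalSpace P] [ChartedSpace EP P]
  {B : SmoothPrincipalBundle EM EG EP M G P}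

variable (B) in
/-- A smooth local section `σ = sec` of `B` over an open set `base`, together with the smooth map
`γ = coord` into `G` that it determines by `u = σ (π u) · γ u`. Outside `base` and its preimage the
values of `sec` and `coord` carry no information. -/
structure LocalSection where
  base : Set M
  sec : M → P
  coord : P → G
  isOpen_base : IsOpen base
  contMDiffOn_sec : ContMDiffOn 𝓘(ℝ, EM) 𝓘(ℝ, EP) ∞ sec base
  contMDiffOn_coord : ContMDiffOn 𝓘(ℝ, EP) 𝓘(ℝ, EG) ∞ coord (B.proj ⁻¹' base)
  proj_sec : ∀ x ∈ base, B.proj (sec x) = x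
  act_coord : ∀ u, B.proj u ∈ base → B.act (sec (B.proj u)) (coord u) = u
  coord_act : ∀ u g, B.proj u ∈ base → coord (B.act u g) = coord u * g
  coord_sec : ∀ x ∈ base, coord (sec x) = 1

variable (B) in
theorem exists_localSection (m : M) : ∃ S : B.LocalSection, m ∈ S.base := by
  obtain ⟨e, hm, he, hesymm, hact⟩ := B.exists_trivialization m
  let σ : M → P := fun x => e.toOpenPartialHomeomorph.symm (x, 1)
  have hproj : ∀ x ∈ e.baseSet, B.proj (σ x) = x := fun x hx => e.proj_symm_apply' hx
  have hcoord : ∀ x ∈ e.baseSet, (e (σ x)).2 = 1 := fun x hx => by rw [e.apply_symm_apply' hx]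
  refine ⟨⟨e.baseSet, σ, fun u => (e u).2, e.open_baseSet, ?_, ?_, hproj, ?_, hact, hcoord⟩, hm⟩
  · exact hesymm.comp (contMDiff_id.prodMk contMDiff_const).contMDiffOn
      fun x hx => e.mem_target.2 hx
  · rw [← e.source_eq]
    exact contMDiff_snd.comp_contMDiffOn he
  · intro u hu
    have hσu : B.proj (σ (B.proj u)) = B.proj u := hproj _ hu
    have hsource : B.act (σ (B.proj u)) (e u).2 ∈ e.source := by
      rwa [e.mem_source, B.proj_act, hσu]
    refine e.injOn hsource (e.mem_source.2 hu) (Prod.ext ?_ ?_)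
    · exact (e.coe_fst hsource).trans (((B.proj_act _ _).trans hσu).trans (e.coe_fst' hu).symm)
    · refine (hact _ _ (by rwa [hσu])).trans ?_
      rw [hcoord _ hu, one_mul]
      rfl

namespace LocalSection

variable (S : B.LocalSection)

theorem eq_zero_of_notMem_base {f : M → ℝ} (hf : tsupport f ⊆ S.base) {x : M} (hx : x ∉ S.base) :
    f x = 0 :=
  image_eq_zero_of_notMem_tsupport fun h => hx (hf h)

/-- The `G`-invariant vector field on `P` whose value at `σ x` is `Y x`. Only its values over
`S.base` are meaningful. -/
def extendFun (Y : M → EP) (u : P) : EP :=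
  mfderiv 𝓘(ℝ, EP) 𝓘(ℝ, EP) (fun p => B.act p (S.coord u)) (S.sec (B.proj u)) (Y (B.proj u))

theorem extendFun_sec (Y : M → EP) {x : M} (hx : x ∈ S.base) :
    S.extendFun Y (S.sec x) = Y x := by
  have hid : (fun p => B.act p 1) = id := funext B.act_one
  unfold extendFun
  rw [S.coord_sec x hx, S.proj_sec x hx, hid, mfderiv_id]
  rfl

theorem mfderiv_proj_sec {x : M} (hx : x ∈ S.base) (w : EM) :
    (mfderiv 𝓘(ℝ, EP) 𝓘(ℝ, EM) B.proj (S.sec x)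
      (mfderiv 𝓘(ℝ, EM) 𝓘(ℝ, EP) S.sec x w) : EM) = w := by
  have hsec : MDifferentiableAt 𝓘(ℝ, EM) 𝓘(ℝ, EP) S.sec x :=
    (S.contMDiffOn_sec.contMDiffAt (S.isOpen_base.mem_nhds hx)).mdifferentiableAt (by simp)
  have hproj : MDifferentiableAt 𝓘(ℝ, EP) 𝓘(ℝ, EM) B.proj (S.sec x) :=
    B.contMDiff_proj.mdifferentiableAt (by simp)
  have hid : B.proj ∘ S.sec =ᶠ[𝓝 x] id := by
    filter_upwards [S.isOpen_base.mem_nhds hx] with y hy using S.proj_sec y hy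
  have hderiv := mfderiv_comp _ hproj hsec
  rw [hid.mfderiv_eq, mfderiv_id] at hderiv
  exact (congrArg (fun l => l w) hderiv).symm

variable [IsManifold 𝓘(ℝ, EP) ∞ P]

section

variable [LieGroup 𝓘(ℝ, EG) ∞ G]

theorem contMDiffOn_extendFun {Y : M → EP} (hY : ContMDiffOn 𝓘(ℝ, EM) 𝓘(ℝ, EP).tangent ∞
      (fun x => (⟨S.sec x, Y x⟩ : TangentBundle 𝓘(ℝ, EP) P)) S.base) :
    ContMDiffOn 𝓘(ℝ, EP) 𝓘(ℝ, EP).tangent ∞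
      (fun u => (⟨u, S.extendFun Y u⟩ : TangentBundle 𝓘(ℝ, EP) P)) (B.proj ⁻¹' S.base) := by
  have hYproj : ContMDiffOn 𝓘(ℝ, EP) 𝓘(ℝ, EP).tangent ∞
      (fun u => (⟨S.sec (B.proj u), Y (B.proj u)⟩ : TangentBundle 𝓘(ℝ, EP) P))
      (B.proj ⁻¹' S.base) := hY.comp B.contMDiff_proj.contMDiffOn subset_rfl
  exact (contMDiffOn_mfderiv_left B.contMDiff_act hYproj S.contMDiffOn_coord).congr
    fun u hu => Bundle.TotalSpace.ext (S.act_coord u hu).symm HEq.rfl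

end

variable [FiniteDimensional ℝ EM] [FiniteDimensional ℝ EP] [IsManifold 𝓘(ℝ, EM) ∞ M]

theorem extendFun_act (Y : M → EP) {u : P} (hu : B.proj u ∈ S.base) (g : G) :
    S.extendFun Y (B.act u g)
      = mfderiv 𝓘(ℝ, EP) 𝓘(ℝ, EP) (fun p => B.act p g) u (S.extendFun Y u) := by
  have hmdiff (g : G) (p : P) : MDifferentiableAt 𝓘(ℝ, EP) 𝓘(ℝ, EP) (fun p => B.act p g) p :=
    (B.contMDiff_act_right g).mdifferentiableAt (by simp)
  have hcomp : (fun p => B.act p (S.coord (B.act u g)))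
      = (fun p => B.act p g) ∘ fun p => B.act p (S.coord u) :=
    funext fun p => by rw [S.coord_act u g hu, Function.comp_apply, B.act_mul]
  have hderiv := mfderiv_comp (S.sec (B.proj u)) (hmdiff g (B.act (S.sec (B.proj u)) (S.coord u)))
    (hmdiff (S.coord u) (S.sec (B.proj u)))
  rw [S.act_coord u hu] at hderiv
  unfold extendFun
  rw [B.proj_act, hcomp]
  exact congrArg (fun l => l (Y (B.proj u))) hderiv

variable [LieGroup 𝓘(ℝ, EG) ∞ G]

section extend

variable {f : C^∞⟮𝓘(ℝ, EM), M; ℝ⟯} (hf : tsupport f ⊆ S.base) {Y : M → EP}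
  (hY : ContMDiffOn 𝓘(ℝ, EM) 𝓘(ℝ, EP).tangent ∞
    (fun x => (⟨S.sec x, Y x⟩ : TangentBundle 𝓘(ℝ, EP) P)) S.base)

/-- The global `G`-invariant vector field on `P` whose value at `σ x` is `f x • Y x`, for `f`
supported in `S.base`. -/
def extend : B.atiyahAlgebra :=
  ⟨⟨fun u => f (B.proj u) • S.extendFun Y u,
    ContMDiffOn.smul_section_of_tsupport (u := B.proj ⁻¹' S.base) (ψ := f ∘ B.proj)
      (f.contMDiff.comp B.contMDiff_proj).contMDiffOn
      (S.isOpen_base.preimage B.contMDiff_proj.continuous)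
      ((tsupport_comp_subset_preimage f B.contMDiff_proj.continuous).trans (Set.preimage_mono hf))
      (S.contMDiffOn_extendFun hY)⟩, fun g u => by
    refine (map_smul _ _ _).trans ?_
    change f (B.proj u) • _ = f (B.proj (B.act u g)) • S.extendFun Y (B.act u g)
    rw [B.proj_act]
    by_cases hu : B.proj u ∈ S.base
    · rw [S.extendFun_act Y hu g]
    · rw [S.eq_zero_of_notMem_base hf hu, zero_smul]
      exact zero_smul ℝ _⟩

theorem extend_sec {x : M} (hx : x ∈ S.base) :
    ((S.extend hf hY).1 (S.sec x) : EP) = f x • Y x := by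
  change f (B.proj (S.sec x)) • S.extendFun Y (S.sec x) = _
  rw [S.extendFun_sec Y hx, S.proj_sec x hx]

theorem anchor_extend {x : M} (hx : x ∈ S.base) :
    (B.anchor (S.extend hf hY) x : EM)
      = f x • (mfderiv 𝓘(ℝ, EP) 𝓘(ℝ, EM) B.proj (S.sec x) (Y x) : EM) := by
  have hanchor := B.anchor_proj (S.extend hf hY) (S.sec x)
  rw [S.proj_sec x hx] at hanchor
  exact hanchor.trans ((congrArg (mfderiv 𝓘(ℝ, EP) 𝓘(ℝ, EM) B.proj (S.sec x))
    (S.extend_sec hf hY hx)).trans (map_smul _ _ _))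

theorem extend_eq_zero {u : P} (hu : f (B.proj u) = 0) : (S.extend hf hY).1 u = 0 := by
  change f (B.proj u) • S.extendFun Y u = 0
  rw [hu, zero_smul]

theorem anchor_extend_eq_zero {x : M} (hx : f x = 0) : B.anchor (S.extend hf hY) x = 0 := by
  obtain ⟨u, rfl⟩ := B.proj_surjective x
  rw [B.anchor_proj, S.extend_eq_zero hf hY hx, map_zero]

end extend

theorem exists_anchor_eq_smul {f : C^∞⟮𝓘(ℝ, EM), M; ℝ⟯} (hf : tsupport f ⊆ S.base)
    (X : SmoothVectorField EM M) : ∃ a : B.atiyahAlgebra, B.anchor a = f • X := by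
  have hY := contMDiffOn_mfderiv_of_isOpen S.isOpen_base S.contMDiffOn_sec
    X.contMDiff_toFun.contMDiffOn fun x hx => hx
  refine ⟨S.extend hf hY, ContMDiffSection.ext fun x => ?_⟩
  rw [SmoothVectorField.smul_apply]
  by_cases hx : x ∈ S.base
  · exact (S.anchor_extend hf hY hx).trans
      (congrArg (f x • ·) (S.mfderiv_proj_sec hx (X x)))
  · have hfx : f x = 0 := S.eq_zero_of_notMem_base hf hx
    rw [S.anchor_extend_eq_zero hf hY hfx, hfx, zero_smul]

end LocalSection

variable [FiniteDimensional ℝ EM] [FiniteDimensional ℝ EP] [IsManifold 𝓘(ℝ, EM) ∞ M]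
  [LieGroup 𝓘(ℝ, EG) ∞ G] [IsManifold 𝓘(ℝ, EP) ∞ P]

variable (B) in
theorem exists_anchor_apply_eq [T2Space M] (m : M) (w : TangentSpace 𝓘(ℝ, EM) m) :
    ∃ a : B.atiyahAlgebra, B.anchor a m = w := by
  obtain ⟨S, hm⟩ := B.exists_localSection m
  obtain ⟨f, hfone, hf⟩ := exists_smooth_eventuallyEq_one (E := EM) (S.isOpen_base.mem_nhds hm)
  obtain ⟨X, hX⟩ := exists_smoothVectorField_apply_eq w
  obtain ⟨a, ha⟩ := S.exists_anchor_eq_smul hf X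
  refine ⟨a, ?_⟩
  rw [ha, SmoothVectorField.smul_apply, hfone.self_of_nhds, Pi.one_apply, one_smul, hX]

end SmoothPrincipalBundle

end LocalSections

noncomputable section PartitionSums

namespace SmoothPrincipalBundle

variable {EM EG EP : Type*} [NormedAddCommGroup EM] [NormedSpace ℝ EM] [FiniteDimensional ℝ EM]
  [NormedAddCommGroup EG] [NormedSpace ℝ EG]
  [NormedAddCommGroup EP] [NormedSpace ℝ EP] [FiniteDimensional ℝ EP]
  {M G P : Type*} [TopologicalSpace M] [ChartedSpace EM M] [IsManifold 𝓘(ℝ, EM) ∞ M]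
  [TopologicalSpace G] [ChartedSpace EG G] [Group G]
  [TopologicalSpace P] [ChartedSpace EP P] [IsManifold 𝓘(ℝ, EP) ∞ P]
  {B : SmoothPrincipalBundle EM EG EP M G P}

section

variable {ι : Type*} (ρ : SmoothPartitionOfUnity ι 𝓘(ℝ, EM) M) (b : ι → B.atiyahAlgebra)

theorem locallyFinite_support_smul :
    LocallyFinite fun i => {u : P | ρ i (B.proj u) • (b i).1 u ≠ 0} :=
  (ρ.locallyFinite.preimage_continuous B.contMDiff_proj.continuous).subset fun i u hu hρ => by
    change ρ i (B.proj u) • (b i).1 u ≠ 0 at hu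
    rw [hρ, zero_smul] at hu
    exact hu rfl

theorem finite_support_smul (u : P) :
    (Function.support fun i => ρ i (B.proj u) • (b i).1 u).Finite :=
  (locallyFinite_support_smul ρ b).point_finite u

/-- The locally finite sum `∑ i, ρ i • b i` of invariant vector fields, for a partition of unity
`ρ` on the base. -/
def partitionSum : B.atiyahAlgebra :=
  ⟨⟨fun u => ∑ᶠ i, ρ i (B.proj u) • (b i).1 u,
    ContMDiff.finsum_section_of_locallyFinite (locallyFinite_support_smul ρ b) fun i =>
      ((ρ i).contMDiff.comp B.contMDiff_proj).smul_section (b i).1.contMDiff⟩, fun g u => by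
    let l := mfderiv 𝓘(ℝ, EP) 𝓘(ℝ, EP) (fun p => B.act p g) u
    refine (l.toLinearMap.toAddMonoidHom.map_finsum (finite_support_smul ρ b u)).trans
      (finsum_congr fun i => (map_smul l _ _).trans ?_)
    rw [B.proj_act]
    exact congrArg (ρ i (B.proj u) • ·) ((b i).2 g u)⟩

theorem lie_partitionSum_apply (h : C^∞⟮𝓘(ℝ, EM), M; ℝ⟯) (x : M) :
    ⁅partitionSum ρ b, h⁆ x = ∑ᶠ i, ρ i x * ⁅b i, h⁆ x := by
  obtain ⟨u, rfl⟩ := B.proj_surjective x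
  let l : TangentSpace 𝓘(ℝ, EP) u →L[ℝ] ℝ := (mvfderiv 𝓘(ℝ, EM) h (B.proj u)).comp
    (mfderiv 𝓘(ℝ, EP) 𝓘(ℝ, EM) B.proj u)
  have hl (c : B.atiyahAlgebra) : ⁅c, h⁆ (B.proj u) = l (c.1 u) := by
    rw [lie_function_apply, anchor_proj]
    rfl
  rw [hl]
  refine (l.toLinearMap.toAddMonoidHom.map_finsum (finite_support_smul ρ b u)).trans
    (finsum_congr fun i => ?_)
  rw [hl]
  exact map_smul l _ _

end

theorem sum_lie_partitionSum_apply {ι κ : Type*} [Fintype κ] [DecidableEq κ]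
    (ρ : SmoothPartitionOfUnity ι 𝓘(ℝ, EM) M) (b : ι → B.atiyahAlgebra) (k : ι → κ)
    (h : κ → C^∞⟮𝓘(ℝ, EM), M; ℝ⟯) (x : M) :
    ∑ j, ⁅partitionSum ρ (fun i => if k i = j then b i else 0), h j⁆ x
      = ∑ᶠ i, ρ i x * ⁅b i, h (k i)⁆ x := by
  have hfin (F : ι → ℝ) : (Function.support fun i => ρ i x * F i).Finite :=
    (ρ.locallyFinite.point_finite x).subset fun i hi => left_ne_zero_of_mul hi
  simp only [lie_partitionSum_apply]
  rw [← finsum_sum_comm _ _ fun j _ => hfin _]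
  refine finsum_congr fun i => ?_
  rw [← Finset.mul_sum, Finset.sum_eq_single (k i) (fun j _ hj => ?_) (by simp), if_pos rfl]
  rw [if_neg hj.symm, lie_function_apply, map_zero]
  exact map_zero _

variable [LieGroup 𝓘(ℝ, EG) ∞ G] [T2Space M]

theorem exists_lie_function_apply_pos (B : SmoothPrincipalBundle EM EG EP M G P)
    {h : C^∞⟮𝓘(ℝ, EM), M; ℝ⟯} {x : M} (hx : mvfderiv 𝓘(ℝ, EM) h x ≠ 0) :
    ∃ b : B.atiyahAlgebra, 0 < ⁅b, h⁆ x := by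
  obtain ⟨w, hw⟩ : ∃ w, mvfderiv 𝓘(ℝ, EM) h x w ≠ 0 := by
    contrapose! hx
    exact ContinuousLinearMap.ext hx
  obtain ⟨b, hb⟩ := B.exists_anchor_apply_eq x (mvfderiv 𝓘(ℝ, EM) h x w • w)
  refine ⟨b, ?_⟩
  rw [lie_function_apply, hb, map_smul]
  exact mul_self_pos.2 hw

theorem exists_forall_sum_lie_function_pos [SecondCountableTopology M]
    (B : SmoothPrincipalBundle EM EG EP M G P) {κ : Type*} [Fintype κ]
    {h : κ → C^∞⟮𝓘(ℝ, EM), M; ℝ⟯} (hne : ∀ x, ∃ i, mvfderiv 𝓘(ℝ, EM) (h i) x ≠ 0) :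
    ∃ a : κ → B.atiyahAlgebra, ∀ x, 0 < ∑ i, ⁅a i, h i⁆ x := by
  classical
  have : LocallyCompactSpace M := ChartedSpace.locallyCompactSpace EM M
  choose k hk using hne
  choose b hb using fun x => B.exists_lie_function_apply_pos (hk x)
  obtain ⟨ρ, hρ⟩ := SmoothPartitionOfUnity.exists_isSubordinate 𝓘(ℝ, EM) (s := Set.univ) (M := M)
    isClosed_univ (fun x => {y | 0 < ⁅b x, h (k x)⁆ y})
    (fun x => isOpen_lt continuous_const (ContMDiffMap.contMDiff _).continuous)
    (fun x _ => Set.mem_iUnion.2 ⟨x, hb x⟩)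
  refine ⟨fun j => partitionSum ρ fun x => if k x = j then b x else 0, fun y => ?_⟩
  rw [sum_lie_partitionSum_apply]
  have hpos (x : M) (hx : ρ x y ≠ 0) : 0 < ⁅b x, h (k x)⁆ y := hρ x (subset_tsupport _ hx)
  obtain ⟨x, hx⟩ := ρ.exists_pos_of_mem (Set.mem_univ y)
  refine finsum_pos (fun x => ?_) ⟨x, mul_pos hx (hpos x hx.ne')⟩
    ((ρ.locallyFinite.point_finite y).subset fun x hx => left_ne_zero_of_mul hx)
  by_cases hxy : ρ x y = 0
  · rw [hxy, zero_mul]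
  · exact mul_nonneg (ρ.nonneg x y) (hpos x hxy).le

theorem exists_isUnit_sum_sq_lie [SecondCountableTopology M]
    (B : SmoothPrincipalBundle EM EG EP M G P) (hM : 0 < Module.finrank ℝ EM) :
    ∃ (a : Fin 2 → B.atiyahAlgebra) (h : Fin 2 → C^∞⟮𝓘(ℝ, EM), M; ℝ⟯),
      IsUnit (∑ i, ⁅a i, h i⁆ ^ 2) := by
  obtain ⟨h, hne⟩ := exists_pair_forall_mvfderiv_ne_zero (M := M) hM
  obtain ⟨a, ha⟩ := B.exists_forall_sum_lie_function_pos hne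
  refine ⟨a, h, isUnit_smooth_of_forall_ne_zero fun y hy => (ha y).ne' ?_⟩
  rw [← evalSmooth_apply, map_sum] at hy
  simp only [map_pow, evalSmooth_apply] at hy
  rw [Finset.sum_eq_zero_iff_of_nonneg fun j _ => sq_nonneg _] at hy
  exact Finset.sum_eq_zero fun j hj => pow_eq_zero_iff two_ne_zero |>.1 (hy j hj)

end SmoothPrincipalBundle

end PartitionSums

section TangentBundleFibre

theorem contMDiffOn_of_totalSpace_mk {E N : Type*} [NormedAddCommGroup E] [NormedSpace ℝ E]
    [TopologicalSpace N] [ChartedSpace E N] [IsManifold 𝓘(ℝ, E) ∞ N]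
    {E' M : Type*} [NormedAddCommGroup E'] [NormedSpace ℝ E'] [TopologicalSpace M]
    [ChartedSpace E' M] (p : N) {F : M → E} {s : Set M}
    (hF : ContMDiffOn 𝓘(ℝ, E') 𝓘(ℝ, E).tangent ∞
      (fun x => (⟨p, F x⟩ : TangentBundle 𝓘(ℝ, E) N)) s) :
    ContMDiffOn 𝓘(ℝ, E') 𝓘(ℝ, E) ∞ F s := by
  have hsnd (v : E) : (trivializationAt E (TangentSpace 𝓘(ℝ, E) : N → Type _) p
      (⟨p, v⟩ : TangentBundle 𝓘(ℝ, E) N)).2 = v :=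
    congrArg Prod.snd ((tangentBundleCore 𝓘(ℝ, E) N).localTrivAt_apply_mk p v)
  exact fun x hx => (Bundle.contMDiffWithinAt_totalSpace.1 (hF x hx)).2.congr
    (fun _ _ => (hsnd _).symm) (hsnd _).symm

end TangentBundleFibre

noncomputable section Fibres

namespace SmoothPrincipalBundle

variable {EM EG EP : Type*} [NormedAddCommGroup EM] [NormedSpace ℝ EM]
  [NormedAddCommGroup EG] [NormedSpace ℝ EG]
  [NormedAddCommGroup EP] [NormedSpace ℝ EP]
  {M G P : Type*} [TopologicalSpace M] [ChartedSpace EM M]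
  [TopologicalSpace G] [ChartedSpace EG G] [Group G]
  [TopologicalSpace P] [ChartedSpace EP P]
  {B : SmoothPrincipalBundle EM EG EP M G P}

theorem contMDiff_act_inv [LieGroup 𝓘(ℝ, EG) ∞ G] (B : SmoothPrincipalBundle EM EG EP M G P) :
    ContMDiff (𝓘(ℝ, EP).prod 𝓘(ℝ, EG)) 𝓘(ℝ, EP) ∞ fun p : P × G => B.act p.1 p.2⁻¹ :=
  B.contMDiff_act.comp (contMDiff_fst.prodMk ((contMDiff_inv 𝓘(ℝ, EG) ∞).comp contMDiff_snd))

namespace LocalSection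

variable (S : B.LocalSection)

/-- The parametrization `g ↦ σ x · g⁻¹` of the fibre over `x`. Because of the inverse, restricting
an invariant vertical field along it gives a left-invariant field on `G`, so that Lie brackets
correspond without a sign. -/
def fibre (x : M) (g : G) : P := B.act (S.sec x) g⁻¹

/-- The smooth map `u ↦ (γ u)⁻¹`, a left inverse of `fibre x` for every `x` in `S.base`. -/
def coordInv (u : P) : G := (S.coord u)⁻¹

theorem fibre_one (x : M) : S.fibre x 1 = S.sec x := by
  rw [fibre, inv_one, B.act_one]

theorem coordInv_sec {x : M} (hx : x ∈ S.base) : S.coordInv (S.sec x) = 1 := by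
  rw [coordInv, S.coord_sec x hx, inv_one]

theorem sec_mem {x : M} (hx : x ∈ S.base) : S.sec x ∈ B.proj ⁻¹' S.base := by
  rwa [Set.mem_preimage, S.proj_sec x hx]

theorem coordInv_fibre {x : M} (hx : x ∈ S.base) (g : G) : S.coordInv (S.fibre x g) = g := by
  rw [coordInv, fibre, S.coord_act _ _ (S.sec_mem hx), S.coord_sec x hx, one_mul, inv_inv]

theorem isOpen_preimage_base : IsOpen (B.proj ⁻¹' S.base) :=
  S.isOpen_base.preimage B.contMDiff_proj.continuous

variable [LieGroup 𝓘(ℝ, EG) ∞ G]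

theorem contMDiff_fibre (x : M) : ContMDiff 𝓘(ℝ, EG) 𝓘(ℝ, EP) ∞ (S.fibre x) :=
  B.contMDiff_act_inv.comp (contMDiff_const.prodMk contMDiff_id)

theorem mdifferentiableAt_fibre (x : M) (g : G) :
    MDifferentiableAt 𝓘(ℝ, EG) 𝓘(ℝ, EP) (S.fibre x) g :=
  (S.contMDiff_fibre x).mdifferentiableAt (by simp)

theorem contMDiffOn_coordInv :
    ContMDiffOn 𝓘(ℝ, EP) 𝓘(ℝ, EG) ∞ S.coordInv (B.proj ⁻¹' S.base) :=
  (contMDiff_inv 𝓘(ℝ, EG) ∞).comp_contMDiffOn S.contMDiffOn_coord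

theorem mdifferentiableAt_coordInv {x : M} (hx : x ∈ S.base) :
    MDifferentiableAt 𝓘(ℝ, EP) 𝓘(ℝ, EG) S.coordInv (S.sec x) :=
  (S.contMDiffOn_coordInv.contMDiffAt
    (S.isOpen_preimage_base.mem_nhds (S.sec_mem hx))).mdifferentiableAt (by simp)

theorem mfderiv_coordInv_fibre {x : M} (hx : x ∈ S.base) (ξ : EG) :
    (mfderiv 𝓘(ℝ, EP) 𝓘(ℝ, EG) S.coordInv (S.sec x)
      (mfderiv 𝓘(ℝ, EG) 𝓘(ℝ, EP) (S.fibre x) 1 ξ : EP) : EG) = ξ := by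
  have hcoord := S.mdifferentiableAt_coordInv hx
  rw [← S.fibre_one x] at hcoord ⊢
  have hderiv := mfderiv_comp _ hcoord (S.mdifferentiableAt_fibre x 1)
  have hid : S.coordInv ∘ S.fibre x = id := funext (S.coordInv_fibre hx)
  rw [hid, mfderiv_id] at hderiv
  exact (congrArg (fun l => l ξ) hderiv).symm

theorem mfderiv_proj_fibre {x : M} (hx : x ∈ S.base) (ξ : EG) :
    (mfderiv 𝓘(ℝ, EP) 𝓘(ℝ, EM) B.proj (S.sec x)
      (mfderiv 𝓘(ℝ, EG) 𝓘(ℝ, EP) (S.fibre x) 1 ξ : EP) : EM) = 0 := by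
  have hderiv := mfderiv_comp (1 : G) (B.contMDiff_proj.mdifferentiableAt (by simp))
    (S.mdifferentiableAt_fibre x 1)
  have hconst : B.proj ∘ S.fibre x = fun _ => x := funext fun g => by
    rw [Function.comp_apply, fibre, B.proj_act, S.proj_sec x hx]
  rw [hconst, mfderiv_const, S.fibre_one] at hderiv
  exact (congrArg (fun l => l ξ) hderiv).symm

theorem mfderiv_act_inv_sec_one (x : M) (ξ : EG) :
    (mfderiv (𝓘(ℝ, EP).prod 𝓘(ℝ, EG)) 𝓘(ℝ, EP) (fun p : P × G => B.act p.1 p.2⁻¹) (S.sec x, 1)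
      ((0, ξ) : EP × EG) : EP) = mfderiv 𝓘(ℝ, EG) 𝓘(ℝ, EP) (S.fibre x) 1 ξ := by
  have hright : MDifferentiableAt 𝓘(ℝ, EG) (𝓘(ℝ, EP).prod 𝓘(ℝ, EG)) (fun g : G => (S.sec x, g)) 1 :=
    mdifferentiableAt_const.prodMk mdifferentiableAt_id
  have hderiv := mfderiv_comp (1 : G) (B.contMDiff_act_inv.mdifferentiableAt (by simp)) hright
  rw [mfderiv_prod_right] at hderiv
  exact (congrArg (fun l => l ξ) hderiv).symm

theorem mfderiv_fibre_coordInv {x : M} (hx : x ∈ S.base) {v : EP}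
    (hv : (mfderiv 𝓘(ℝ, EP) 𝓘(ℝ, EM) B.proj (S.sec x) v : EM) = 0) :
    (mfderiv 𝓘(ℝ, EG) 𝓘(ℝ, EP) (S.fibre x) 1
      (mfderiv 𝓘(ℝ, EP) 𝓘(ℝ, EG) S.coordInv (S.sec x) v : EG) : EP) = v := by
  let F : P × G → P := fun p => B.act p.1 p.2⁻¹
  let c : P → P × G := fun u => ((S.sec ∘ B.proj) u, S.coordInv u)
  have hc : c (S.sec x) = (S.sec x, 1) :=
    Prod.ext (congrArg S.sec (S.proj_sec x hx)) (S.coordInv_sec hx)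
  have hproj : MDifferentiableAt 𝓘(ℝ, EP) 𝓘(ℝ, EM) B.proj (S.sec x) :=
    B.contMDiff_proj.mdifferentiableAt (by simp)
  have hsec : MDifferentiableAt 𝓘(ℝ, EM) 𝓘(ℝ, EP) S.sec (B.proj (S.sec x)) :=
    (S.contMDiffOn_sec.contMDiffAt (S.isOpen_base.mem_nhds (S.sec_mem hx))).mdifferentiableAt
      (by simp)
  have hcoordInv := S.mdifferentiableAt_coordInv hx
  have hid : F ∘ c =ᶠ[𝓝 (S.sec x)] id := by
    filter_upwards [S.isOpen_preimage_base.mem_nhds (S.sec_mem hx)] with u hu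
    exact (congrArg (B.act _) (inv_inv _)).trans (S.act_coord u hu)
  have hderiv := mfderiv_comp (S.sec x) (B.contMDiff_act_inv.mdifferentiableAt (by simp))
    ((hsec.comp _ hproj).prodMk hcoordInv)
  rw [hid.mfderiv_eq, mfderiv_id, mfderiv_prodMk (hsec.comp _ hproj) hcoordInv,
    mfderiv_comp _ hsec hproj] at hderiv
  have hhorizontal : (mfderiv 𝓘(ℝ, EM) 𝓘(ℝ, EP) S.sec (B.proj (S.sec x))
      (mfderiv 𝓘(ℝ, EP) 𝓘(ℝ, EM) B.proj (S.sec x) v : EM) : EP) = 0 :=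
    (congrArg (mfderiv 𝓘(ℝ, EM) 𝓘(ℝ, EP) S.sec (B.proj (S.sec x))) hv).trans (map_zero _)
  refine (S.mfderiv_act_inv_sec_one x _).symm.trans
    (Eq.trans ?_ (congrArg (fun l => l v) hderiv).symm)
  refine (congrArg (fun l : EP × EG →L[ℝ] EP => l _) (mfderiv_congr_point hc.symm)).trans ?_
  exact congrArg (fun w : EP => mfderiv (𝓘(ℝ, EP).prod 𝓘(ℝ, EG)) 𝓘(ℝ, EP) F (c (S.sec x))
    ((w, mfderiv 𝓘(ℝ, EP) 𝓘(ℝ, EG) S.coordInv (S.sec x) v) : EP × EG)) hhorizontal.symm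

theorem contMDiffOn_mfderiv_fibre [IsManifold 𝓘(ℝ, EP) ∞ P] (ξ : EG) :
    ContMDiffOn 𝓘(ℝ, EM) 𝓘(ℝ, EP).tangent ∞ (fun x => (⟨S.sec x,
      (mfderiv 𝓘(ℝ, EG) 𝓘(ℝ, EP) (S.fibre x) 1 ξ : EP)⟩ : TangentBundle 𝓘(ℝ, EP) P)) S.base :=
  (contMDiffOn_mfderiv_right B.contMDiff_act_inv S.contMDiffOn_sec (b := fun _ => ⟨1, ξ⟩)
    contMDiffOn_const).congr
    fun x _ => Bundle.TotalSpace.ext (S.fibre_one x).symm HEq.rfl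

variable [FiniteDimensional ℝ EM] [FiniteDimensional ℝ EP] [IsManifold 𝓘(ℝ, EM) ∞ M]
  [IsManifold 𝓘(ℝ, EP) ∞ P]

/-- The vertical component at `σ x` of an invariant vector field, in the trivialization given by
`S`. -/
def evalAt (x : M) (a : B.atiyahAlgebra) : GroupLieAlgebra 𝓘(ℝ, EG) G :=
  (mfderiv 𝓘(ℝ, EP) 𝓘(ℝ, EG) S.coordInv (S.sec x) (a.1 (S.sec x)) : EG)

theorem contMDiffOn_evalAt (a : B.atiyahAlgebra) :
    ContMDiffOn 𝓘(ℝ, EM) 𝓘(ℝ, EG) ∞ (M' := EG) (fun x => S.evalAt x a) S.base := by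
  refine contMDiffOn_of_totalSpace_mk (1 : G) ?_
  exact (contMDiffOn_mfderiv_of_isOpen S.isOpen_preimage_base S.contMDiffOn_coordInv
    (a.1.contMDiff_toFun.comp_contMDiffOn S.contMDiffOn_sec) fun x hx => S.sec_mem hx).congr
    fun x hx => Bundle.TotalSpace.ext (S.coordInv_sec hx).symm HEq.rfl

theorem mfderiv_fibre_evalAt {x : M} (hx : x ∈ S.base) {k : B.atiyahAlgebra}
    (hk : k ∈ B.kernelAlgebra) :
    (mfderiv 𝓘(ℝ, EG) 𝓘(ℝ, EP) (S.fibre x) 1 (S.evalAt x k) : EP) = k.1 (S.sec x) :=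
  S.mfderiv_fibre_coordInv hx ((B.anchor_proj k (S.sec x)).symm.trans
    (by rw [B.anchor.mem_ker.1 hk]; rfl))

theorem related_fibre {x : M} (hx : x ∈ S.base) {k : B.atiyahAlgebra} (hk : k ∈ B.kernelAlgebra) :
    (leftInvariantField (S.evalAt x k)).Related (S.fibre x) k.1 := by
  intro g
  have hact : MDifferentiableAt 𝓘(ℝ, EP) 𝓘(ℝ, EP) (fun p => B.act p g⁻¹) (S.fibre x 1) :=
    (B.contMDiff_act_right g⁻¹).mdifferentiableAt (by simp)
  have hmul : MDifferentiableAt 𝓘(ℝ, EG) 𝓘(ℝ, EG) (fun z : G => g * z) 1 :=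
    (contMDiff_mul_left (I := 𝓘(ℝ, EG)) (n := ∞)).mdifferentiableAt (by simp)
  have hequivariant : (fun p => B.act p g⁻¹) ∘ S.fibre x = S.fibre x ∘ fun z => g * z :=
    funext fun z => by simp only [Function.comp_apply, fibre, mul_inv_rev, B.act_mul]
  have hderiv := mfderiv_comp (1 : G) hact (S.mdifferentiableAt_fibre x 1)
  rw [hequivariant, mfderiv_comp (1 : G) (S.mdifferentiableAt_fibre x (g * 1)) hmul] at hderiv
  have hfibre := S.mfderiv_fibre_evalAt hx hk
  rw [← S.fibre_one] at hfibre
  refine (congrArg (fun l : EG →L[ℝ] EP => l (leftInvariantField (S.evalAt x k) g))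
    (mfderiv_congr_point (mul_one g).symm)).trans ?_
  refine (congrArg (fun l => l (S.evalAt x k)) hderiv).trans ?_
  refine (congrArg (mfderiv 𝓘(ℝ, EP) 𝓘(ℝ, EP) (fun p => B.act p g⁻¹) (S.fibre x 1))
    hfibre).trans ?_
  refine (k.2 g⁻¹ _).trans ?_
  rw [S.fibre_one]
  rfl

variable [FiniteDimensional ℝ EG]

/-- Evaluation at `x` of the kernel of the anchor, read in the Lie algebra of `G` by means of `S`,
as a morphism of Lie algebras. -/
def evalHom {x : M} (hx : x ∈ S.base) : B.kernelAlgebra →ₗ⁅ℝ⁆ GroupLieAlgebra 𝓘(ℝ, EG) G where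
  toFun k := S.evalAt x k
  map_add' _ _ := map_add (mfderiv 𝓘(ℝ, EP) 𝓘(ℝ, EG) S.coordInv (S.sec x)) _ _
  map_smul' c _ := map_smul (mfderiv 𝓘(ℝ, EP) 𝓘(ℝ, EG) S.coordInv (S.sec x)) c _
  map_lie' {k l} := by
    have hrelated := (S.related_fibre hx k.2).lie (S.contMDiff_fibre x) (S.related_fibre hx l.2) 1
    have hone : (⁅k.1.1, l.1.1⁆ (S.fibre x 1) : EP) = ⁅k.1.1, l.1.1⁆ (S.sec x) := by
      rw [S.fibre_one]
    refine Eq.trans ?_ (S.mfderiv_coordInv_fibre hx _)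
    exact congrArg (mfderiv 𝓘(ℝ, EP) 𝓘(ℝ, EG) S.coordInv (S.sec x)) (hrelated.trans hone).symm

theorem evalHom_apply {x : M} (hx : x ∈ S.base) (k : B.kernelAlgebra) :
    S.evalHom hx k = S.evalAt x k := rfl

theorem evalHom_smul {x : M} (hx : x ∈ S.base) (f : C^∞⟮𝓘(ℝ, EM), M; ℝ⟯) (k : B.kernelAlgebra) :
    S.evalHom hx (f • k) = f x • S.evalHom hx k := by
  have hsmul : ((f • k.1).1 (S.sec x) : EP) = f x • k.1.1 (S.sec x) := by
    rw [smul_apply, S.proj_sec x hx]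
  exact (congrArg (mfderiv 𝓘(ℝ, EP) 𝓘(ℝ, EG) S.coordInv (S.sec x)) hsmul).trans
    (map_smul (mfderiv 𝓘(ℝ, EP) 𝓘(ℝ, EG) S.coordInv (S.sec x)) _ _)

theorem evalHom_eq_zero_iff {x : M} (hx : x ∈ S.base) (k : B.kernelAlgebra) :
    S.evalHom hx k = 0 ↔ k ∈ B.kernelVanishingAt x := by
  refine ⟨fun h u hu => ?_, fun h => ?_⟩
  · have hsec : (k.1.1 (S.sec x) : EP) = 0 := by
      rw [← S.mfderiv_fibre_evalAt hx k.2, ← S.evalHom_apply hx, h]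
      exact map_zero _
    obtain ⟨g, rfl⟩ := B.exists_act_eq ((S.proj_sec x hx).trans hu.symm)
    exact (k.1.2 g _).symm.trans
      ((congrArg (mfderiv 𝓘(ℝ, EP) 𝓘(ℝ, EP) (fun u => B.act u g) _) hsec).trans (map_zero _))
  · exact (congrArg (mfderiv 𝓘(ℝ, EP) 𝓘(ℝ, EG) S.coordInv (S.sec x))
      (h _ (S.proj_sec x hx))).trans (map_zero _)

theorem kernel_ext {k l : B.kernelAlgebra}
    (hbase : ∀ x (hx : x ∈ S.base), S.evalHom hx k = S.evalHom hx l)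
    (hk : ∀ x ∉ S.base, k ∈ B.kernelVanishingAt x) (hl : ∀ x ∉ S.base, l ∈ B.kernelVanishingAt x) :
    k = l := by
  refine Subtype.ext (B.atiyahAlgebra_ext fun u => ?_)
  by_cases hu : B.proj u ∈ S.base
  · exact sub_eq_zero.1
      ((S.evalHom_eq_zero_iff hu (k - l)).1 (by rw [map_sub, hbase _ hu, sub_self]) u rfl)
  · exact (hk _ hu u rfl).trans (hl _ hu u rfl).symm

end LocalSection

end SmoothPrincipalBundle

end Fibres

noncomputable section VerticalFields

namespace SmoothPrincipalBundle

variable {EM EG EP : Type*} [NormedAddCommGroup EM] [NormedSpace ℝ EM] [FiniteDimensional ℝ EM]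
  [NormedAddCommGroup EG] [NormedSpace ℝ EG]
  [NormedAddCommGroup EP] [NormedSpace ℝ EP] [FiniteDimensional ℝ EP]
  {M G P : Type*} [TopologicalSpace M] [ChartedSpace EM M] [IsManifold 𝓘(ℝ, EM) ∞ M]
  [TopologicalSpace G] [ChartedSpace EG G] [Group G]
  [TopologicalSpace P] [ChartedSpace EP P] [IsManifold 𝓘(ℝ, EP) ∞ P]
  {B : SmoothPrincipalBundle EM EG EP M G P}

theorem smul_mem_kernelVanishingAt {f : C^∞⟮𝓘(ℝ, EM), M; ℝ⟯} {x : M} (hf : f x = 0)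
    (k : B.kernelAlgebra) : f • k ∈ B.kernelVanishingAt x := fun u hu =>
  (congrArg (· • k.1.1 u) ((congrArg f hu).trans hf)).trans (zero_smul ℝ _)

theorem lie_mem_kernelVanishingAt {x : M} {k l : B.kernelAlgebra}
    (hk : k ∈ B.kernelVanishingAt x) (hl : l ∈ B.kernelVanishingAt x) :
    ⁅k, l⁆ ∈ B.kernelVanishingAt x := fun u hu =>
  SmoothVectorField.lie_apply_eq_zero (hk u hu) (hl u hu)

namespace LocalSection

variable [LieGroup 𝓘(ℝ, EG) ∞ G] (S : B.LocalSection) {χ : C^∞⟮𝓘(ℝ, EM), M; ℝ⟯}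
  (hχ : tsupport χ ⊆ S.base)

/-- The invariant vertical vector field whose vertical component along the section is `χ • ξ`. -/
def verticalField (ξ : GroupLieAlgebra 𝓘(ℝ, EG) G) : B.kernelAlgebra :=
  ⟨S.extend hχ (S.contMDiffOn_mfderiv_fibre ξ), B.anchor.mem_ker.2 <|
    ContMDiffSection.ext fun x => by
      by_cases hx : x ∈ S.base
      · exact (S.anchor_extend hχ _ hx).trans
          ((congrArg (fun w : EM => χ x • w) (S.mfderiv_proj_fibre hx ξ)).trans
            (smul_zero (A := EM) _))
      · exact S.anchor_extend_eq_zero hχ _ (S.eq_zero_of_notMem_base hχ hx)⟩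

theorem verticalField_mem_kernelVanishingAt (ξ : GroupLieAlgebra 𝓘(ℝ, EG) G) {x : M}
    (hx : χ x = 0) : S.verticalField hχ ξ ∈ B.kernelVanishingAt x := fun _ hu =>
  S.extend_eq_zero hχ (S.contMDiffOn_mfderiv_fibre ξ) ((congrArg χ hu).trans hx)

variable [FiniteDimensional ℝ EG]

theorem evalHom_verticalField (ξ : GroupLieAlgebra 𝓘(ℝ, EG) G) {x : M} (hx : x ∈ S.base) :
    S.evalHom hx (S.verticalField hχ ξ) = χ x • ξ := by
  refine (congrArg (mfderiv 𝓘(ℝ, EP) 𝓘(ℝ, EG) S.coordInv (S.sec x))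
    (S.extend_sec hχ (S.contMDiffOn_mfderiv_fibre ξ) hx)).trans ?_
  exact (map_smul _ _ _).trans (congrArg (χ x • ·) (S.mfderiv_coordInv_fibre hx ξ))

/-- `verticalField` as a linear map of the Lie algebra of `G`. -/
def vertical : GroupLieAlgebra 𝓘(ℝ, EG) G →ₗ[ℝ] B.kernelAlgebra where
  toFun := S.verticalField hχ
  map_add' ξ η := S.kernel_ext
    (fun x hx => by simp only [map_add, evalHom_verticalField, smul_add])
    (fun x hx => S.verticalField_mem_kernelVanishingAt hχ _ (S.eq_zero_of_notMem_base hχ hx))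
    (fun x hx => Submodule.add_mem _
      (S.verticalField_mem_kernelVanishingAt hχ ξ (S.eq_zero_of_notMem_base hχ hx))
      (S.verticalField_mem_kernelVanishingAt hχ η (S.eq_zero_of_notMem_base hχ hx)))
  map_smul' c ξ := S.kernel_ext
    (fun x hx => by simp only [map_smul, evalHom_verticalField, smul_comm c, RingHom.id_apply])
    (fun x hx => S.verticalField_mem_kernelVanishingAt hχ _ (S.eq_zero_of_notMem_base hχ hx))
    (fun x hx => Submodule.smul_mem _ c
      (S.verticalField_mem_kernelVanishingAt hχ ξ (S.eq_zero_of_notMem_base hχ hx)))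

theorem evalHom_vertical (ξ : GroupLieAlgebra 𝓘(ℝ, EG) G) {x : M} (hx : x ∈ S.base) :
    S.evalHom hx (S.vertical hχ ξ) = χ x • ξ :=
  S.evalHom_verticalField hχ ξ hx

theorem vertical_mem_kernelVanishingAt (ξ : GroupLieAlgebra 𝓘(ℝ, EG) G) {x : M} (hx : χ x = 0) :
    S.vertical hχ ξ ∈ B.kernelVanishingAt x :=
  S.verticalField_mem_kernelVanishingAt hχ ξ hx

theorem lie_vertical (ξ η : GroupLieAlgebra 𝓘(ℝ, EG) G) :
    ⁅S.vertical hχ ξ, S.vertical hχ η⁆ = χ • S.vertical hχ ⁅ξ, η⁆ := by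
  refine S.kernel_ext (fun x hx => ?_) (fun x hx => ?_) (fun x hx => ?_)
  · rw [LieHom.map_lie, evalHom_smul, evalHom_vertical, evalHom_vertical, evalHom_vertical,
      smul_lie, lie_smul]
  · have hχx := S.eq_zero_of_notMem_base hχ hx
    exact lie_mem_kernelVanishingAt (S.vertical_mem_kernelVanishingAt hχ ξ hχx)
      (S.vertical_mem_kernelVanishingAt hχ η hχx)
  · exact smul_mem_kernelVanishingAt (S.eq_zero_of_notMem_base hχ hx) _

theorem sq_smul_eq_sum_smul_vertical {ι : Type*} [Fintype ι]
    (b : Module.Basis ι ℝ (GroupLieAlgebra 𝓘(ℝ, EG) G)) (k : B.kernelAlgebra)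
    {c : ι → C^∞⟮𝓘(ℝ, EM), M; ℝ⟯} (hc : ∀ i x, c i x = χ x * b.repr (S.evalAt x k) i) :
    χ ^ 2 • k = ∑ i, c i • S.vertical hχ (b i) := by
  refine S.kernel_ext (fun x hx => ?_) (fun x hx => ?_) (fun x hx => ?_)
  · have hsummand (i : ι) : S.evalHom hx (c i • S.vertical hχ (b i))
        = χ x ^ 2 • (b.repr (S.evalHom hx k) i • b i) := by
      rw [evalHom_smul, evalHom_vertical, hc, smul_smul, smul_smul, evalHom_apply]
      congr 1
      ring
    rw [map_sum, Finset.sum_congr rfl fun i _ => hsummand i, ← Finset.smul_sum, b.sum_repr,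
      evalHom_smul]
    rfl
  · refine smul_mem_kernelVanishingAt ?_ k
    rw [sq, ContMDiffMap.coe_mul, Pi.mul_apply, S.eq_zero_of_notMem_base hχ hx, zero_mul]
  · refine Submodule.sum_mem _ fun i _ => smul_mem_kernelVanishingAt ?_ _
    rw [hc, S.eq_zero_of_notMem_base hχ hx, zero_mul]

include hχ in
theorem exists_smooth_eq_mul_repr {ι : Type*}
    (b : Module.Basis ι ℝ (GroupLieAlgebra 𝓘(ℝ, EG) G)) (k : B.kernelAlgebra) :
    ∃ c : ι → C^∞⟮𝓘(ℝ, EM), M; ℝ⟯, ∀ i x, c i x = χ x * b.repr (S.evalAt x k) i := by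
  let coord : ι → EG →L[ℝ] ℝ := fun i => LinearMap.toContinuousLinearMap (E := EG) (b.coord i)
  choose c hc using fun i => exists_smooth_eq_mul S.isOpen_base hχ
    ((coord i).contMDiff.comp_contMDiffOn (S.contMDiffOn_evalAt k.1))
  exact ⟨c, hc⟩

theorem exists_sq_smul_eq_sum {ι : Type*} [Fintype ι]
    (b : Module.Basis ι ℝ (GroupLieAlgebra 𝓘(ℝ, EG) G)) (k : B.kernelAlgebra) :
    ∃ c : ι → C^∞⟮𝓘(ℝ, EM), M; ℝ⟯, χ ^ 2 • k = ∑ i, c i • S.vertical hχ (b i) ∧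
      ∀ x ∈ S.base, k ∈ B.kernelVanishingAt x → ∀ i, c i x = 0 := by
  obtain ⟨c, hc⟩ := S.exists_smooth_eq_mul_repr hχ b k
  refine ⟨c, S.sq_smul_eq_sum_smul_vertical hχ b k hc, fun x hx hk i => ?_⟩
  rw [hc, ← S.evalHom_apply hx, (S.evalHom_eq_zero_iff hx k).2 hk, map_zero, Finsupp.zero_apply,
    mul_zero]

section IsSemisimple

variable [LieAlgebra.IsSemisimple ℝ (GroupLieAlgebra 𝓘(ℝ, EG) G)]
  {J : Submodule ℝ B.kernelAlgebra} (hJ : ∀ k l : B.kernelAlgebra, ⁅k, l⁆ ∈ J)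
include hJ

theorem smul_smul_vertical_mem (f : C^∞⟮𝓘(ℝ, EM), M; ℝ⟯) (ξ : GroupLieAlgebra 𝓘(ℝ, EG) G) :
    f • χ • S.vertical hχ ξ ∈ J := by
  have hperfect : (⊤ : LieIdeal ℝ (GroupLieAlgebra 𝓘(ℝ, EG) G))
      = ⁅(⊤ : LieIdeal ℝ (GroupLieAlgebra 𝓘(ℝ, EG) G)), ⊤⁆ :=
    (lie_self_eq_of_isSemisimple _).symm
  have hξ : ξ ∈ (⊤ : LieIdeal ℝ (GroupLieAlgebra 𝓘(ℝ, EG) G)).toSubmodule := trivial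
  rw [hperfect, LieSubmodule.lieIdeal_oper_eq_linear_span'] at hξ
  induction hξ using Submodule.span_induction with
  | mem ξ hbracket =>
    obtain ⟨η, -, ζ, -, rfl⟩ := hbracket
    rw [← lie_vertical, ← lie_smul]
    exact hJ _ _
  | zero => simp only [map_zero, smul_zero, J.zero_mem]
  | add ξ η _ _ hξ hη =>
    rw [map_add, smul_add, smul_add]
    exact J.add_mem hξ hη
  | smul c ξ _ hξ =>
    rw [map_smul, smul_algebra_smul_comm c χ, smul_algebra_smul_comm c f]
    exact J.smul_mem c hξ

include S hχ in
theorem cube_mem_multiplierIdeal : χ ^ 3 ∈ multiplierIdeal C^∞⟮𝓘(ℝ, EM), M; ℝ⟯ J := by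
  intro k
  obtain ⟨c, hc, -⟩ := S.exists_sq_smul_eq_sum hχ (Module.finBasis ℝ EG) k
  rw [pow_succ', mul_smul, hc, Finset.smul_sum]
  refine J.sum_mem fun i _ => ?_
  rw [smul_comm]
  exact S.smul_smul_vertical_mem hχ hJ _ _

end IsSemisimple

end LocalSection

end SmoothPrincipalBundle

end VerticalFields

section IsotropySubalgebras

namespace SmoothPrincipalBundle

variable {EM EG EP : Type*} [NormedAddCommGroup EM] [NormedSpace ℝ EM] [FiniteDimensional ℝ EM]
  [NormedAddCommGroup EG] [NormedSpace ℝ EG]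
  [NormedAddCommGroup EP] [NormedSpace ℝ EP] [FiniteDimensional ℝ EP]
  {M G P : Type*} [TopologicalSpace M] [ChartedSpace EM M] [IsManifold 𝓘(ℝ, EM) ∞ M]
  [TopologicalSpace G] [ChartedSpace EG G] [Group G]
  [TopologicalSpace P] [ChartedSpace EP P] [IsManifold 𝓘(ℝ, EP) ∞ P]
  (B : SmoothPrincipalBundle EM EG EP M G P)

theorem mem_isotropySubalgebra {m : M} {a : B.atiyahAlgebra} :
    a ∈ B.isotropySubalgebra m ↔ B.anchor a m = 0 := Iff.rfl

theorem cofg_isotropySubalgebra (m : M) : (B.isotropySubalgebra m).toSubmodule.CoFG := by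
  let anchorAt : B.atiyahAlgebra →ₗ[ℝ] EM :=
    { toFun a := B.anchor a m
      map_add' a b := by rw [map_add]; rfl
      map_smul' c a := by rw [map_smul]; rfl }
  have hker : (B.isotropySubalgebra m).toSubmodule = LinearMap.ker anchorAt :=
    Submodule.ext fun a => (LinearMap.mem_ker (f := anchorAt)).symm
  rw [hker]
  exact Submodule.CoFG.ker anchorAt

theorem smul_mem_isotropySubalgebra {f : C^∞⟮𝓘(ℝ, EM), M; ℝ⟯} {m : M} (hf : f m = 0)
    (a : B.atiyahAlgebra) : f • a ∈ B.isotropySubalgebra m := by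
  rw [mem_isotropySubalgebra, anchor_smul, SmoothVectorField.smul_apply, hf, zero_smul]

theorem exists_lie_function_apply_eq_one [T2Space M] {m : M} {a : B.atiyahAlgebra}
    (ha : a ∉ B.isotropySubalgebra m) :
    ∃ f : C^∞⟮𝓘(ℝ, EM), M; ℝ⟯, f m = 0 ∧ ⁅a, f⁆ m = 1 := by
  obtain ⟨f, hf, hdf⟩ := exists_smooth_mvfderiv_eq_one ha
  exact ⟨f, hf, by rw [lie_function_apply, hdf]⟩

theorem sub_lie_smul_mem_isotropySubalgebra {f : C^∞⟮𝓘(ℝ, EM), M; ℝ⟯} {m : M}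
    {a : B.atiyahAlgebra} (hf : f m = 0) (haf : ⁅a, f⁆ m = 1) (c : B.atiyahAlgebra) :
    c - ⁅a, f • c⁆ ∈ B.isotropySubalgebra m := by
  have hsplit : c - ⁅a, f • c⁆ = (1 - ⁅a, f⁆) • c - f • ⁅a, c⁆ := by
    rw [LieRinehartRing.leibniz_smul_right, sub_smul, one_smul]
    abel
  rw [hsplit]
  refine sub_mem (B.smul_mem_isotropySubalgebra ?_ c) (B.smul_mem_isotropySubalgebra hf _)
  exact sub_eq_zero.2 haf.symm

theorem eq_top_of_isotropySubalgebra_lt [T2Space M] {m : M} {T : LieSubalgebra ℝ B.atiyahAlgebra}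
    (h : B.isotropySubalgebra m < T) : T = ⊤ := by
  obtain ⟨hle, a, haT, ha⟩ := SetLike.lt_iff_le_and_exists.1 h
  obtain ⟨f, hf, haf⟩ := B.exists_lie_function_apply_eq_one ha
  refine eq_top_iff.2 fun c _ => ?_
  have hbracket : ⁅a, f • c⁆ ∈ T := T.lie_mem haT (hle (B.smul_mem_isotropySubalgebra hf c))
  simpa only [sub_add_cancel] using
    T.add_mem (hle (B.sub_lie_smul_mem_isotropySubalgebra hf haf c)) hbracket

theorem mem_isotropySubalgebra_of_forall_lie_mem [T2Space M] {J : Ideal C^∞⟮𝓘(ℝ, EM), M; ℝ⟯}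
    [Algebra.IsAlgebraic ℝ (C^∞⟮𝓘(ℝ, EM), M; ℝ⟯ ⧸ J)] {x : M} (hx : ∀ f ∈ J, f x = 0)
    {a : B.atiyahAlgebra} (ha : ∀ f ∈ J, ⁅a, f⁆ ∈ J) : a ∈ B.isotropySubalgebra x := by
  by_contra hax
  obtain ⟨f, -, haf⟩ := B.exists_lie_function_apply_eq_one hax
  have hzero := eval_derivation_eq_zero
    (d := LieRinehartAlgebra.anchor ℝ C^∞⟮𝓘(ℝ, EM), M; ℝ⟯ B.atiyahAlgebra a) ha (evalSmooth x) hx f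
  exact one_ne_zero (haf.symm.trans hzero)

variable [LieGroup 𝓘(ℝ, EG) ∞ G] [T2Space M] (hM : 0 < Module.finrank ℝ EM)
include hM

theorem exists_anchor_apply_ne_zero (m : M) : ∃ a, B.anchor a m ≠ 0 := by
  have : Nontrivial EM := Module.nontrivial_of_finrank_pos hM
  obtain ⟨w, hw⟩ := exists_ne (0 : EM)
  obtain ⟨a, ha⟩ := B.exists_anchor_apply_eq m w
  exact ⟨a, fun h => hw (ha.symm.trans h)⟩

theorem isotropySubalgebra_ne_top (m : M) : B.isotropySubalgebra m ≠ ⊤ := by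
  obtain ⟨a, ha⟩ := B.exists_anchor_apply_ne_zero hM m
  exact fun h => ha (B.mem_isotropySubalgebra.1 (h ▸ LieSubalgebra.mem_top a))

theorem isMaximalFiniteCodim_isotropySubalgebra (m : M) :
    (B.isotropySubalgebra m).IsMaximalFiniteCodim :=
  ⟨B.isotropySubalgebra_ne_top hM m, B.cofg_isotropySubalgebra m,
    fun _ hT _ hlt => hT (B.eq_top_of_isotropySubalgebra_lt hlt)⟩

theorem eq_of_isotropySubalgebra_le {m m' : M}
    (h : B.isotropySubalgebra m ≤ B.isotropySubalgebra m') : m' = m := by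
  by_contra hne
  obtain ⟨a, ha⟩ := B.exists_anchor_apply_ne_zero hM m'
  obtain ⟨f, hfone, hfsupp⟩ := exists_smooth_eventuallyEq_one (E := EM)
    ((isOpen_compl_singleton (x := m)).mem_nhds hne)
  have hfm : f m = 0 := image_eq_zero_of_notMem_tsupport fun hm => hfsupp hm rfl
  have hfm' : f m' = 1 := hfone.self_of_nhds
  have hfa := B.mem_isotropySubalgebra.1 (h (B.smul_mem_isotropySubalgebra hfm a))
  rw [anchor_smul, SmoothVectorField.smul_apply, hfm', one_smul] at hfa
  exact ha hfa

variable [SecondCountableTopology M]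

theorem exists_le_isotropySubalgebra {T : LieSubalgebra ℝ B.atiyahAlgebra} (hT : T ≠ ⊤)
    (hTfin : T.toSubmodule.CoFG) : ∃ x, T ≤ B.isotropySubalgebra x := by
  have : LocallyCompactSpace M := ChartedSpace.locallyCompactSpace EM M
  obtain ⟨a, h, hunit⟩ := B.exists_isUnit_sum_sq_lie hM
  have := isAlgebraic_quotient_multiplierIdeal hTfin a h hunit
  obtain ⟨x, hx⟩ := exists_forall_mem_eq_zero (multiplierIdeal_ne_top
    (R := C^∞⟮𝓘(ℝ, EM), M; ℝ⟯) (LieSubalgebra.toSubmodule_injective.ne hT))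
  exact ⟨x, fun c hc => B.mem_isotropySubalgebra_of_forall_lie_mem hx fun f hf =>
    lie_mem_multiplierIdeal (fun _ => T.lie_mem hc) hf⟩

theorem exists_eq_isotropySubalgebra_of_isMaximalFiniteCodim
    {T : LieSubalgebra ℝ B.atiyahAlgebra} (hT : T.IsMaximalFiniteCodim) :
    ∃ m, T = B.isotropySubalgebra m := by
  obtain ⟨m, hTm⟩ := B.exists_le_isotropySubalgebra hM hT.1 hT.2.1
  refine ⟨m, by_contra fun hne => ?_⟩
  exact hT.2.2 _ (B.isotropySubalgebra_ne_top hM m) (B.cofg_isotropySubalgebra m)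
    (lt_of_le_of_ne hTm hne)

end SmoothPrincipalBundle

end IsotropySubalgebras

section NormalizedIdeals

theorem mem_ambientNormalizer_iff {L : Type*} [LieRing L] [LieAlgebra ℝ L] {K : LieIdeal ℝ L}
    {J : LieIdeal ℝ K} {a : L} : a ∈ K.ambientNormalizer J ↔ ∀ k ∈ J, ⁅a, k⁆ ∈ J := by
  rw [LieIdeal.mem_ambientNormalizer]
  refine forall₂_congr fun k _ => ⟨?_, fun h => ⟨_, h, rfl⟩⟩
  rintro ⟨k', hk', hbracket⟩
  rwa [← (Subtype.ext hbracket : k' = ⁅a, k⁆)]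

namespace SmoothPrincipalBundle

variable {EM EG EP : Type*} [NormedAddCommGroup EM] [NormedSpace ℝ EM] [FiniteDimensional ℝ EM]
  [NormedAddCommGroup EG] [NormedSpace ℝ EG] [NormedAddCommGroup EP] [NormedSpace ℝ EP]
  {M G P : Type*} [TopologicalSpace M] [ChartedSpace EM M] [IsManifold 𝓘(ℝ, EM) ∞ M]
  [TopologicalSpace G] [ChartedSpace EG G] [Group G] [TopologicalSpace P] [ChartedSpace EP P]
  (B : SmoothPrincipalBundle EM EG EP M G P)

theorem exists_cutoff [T2Space M] (m : M) : ∃ (S : B.LocalSection) (χ : C^∞⟮𝓘(ℝ, EM), M; ℝ⟯),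
    m ∈ S.base ∧ tsupport χ ⊆ S.base ∧ χ m = 1 := by
  obtain ⟨S, hm⟩ := B.exists_localSection m
  obtain ⟨χ, hone, hχ⟩ := exists_smooth_eventuallyEq_one (E := EM) (S.isOpen_base.mem_nhds hm)
  exact ⟨S, χ, hm, hχ, hone.self_of_nhds⟩

variable [FiniteDimensional ℝ EP] [IsManifold 𝓘(ℝ, EP) ∞ P]

theorem lie_smul_mem_kernelVanishingAt {m : M} {a : B.atiyahAlgebra}
    (ha : a ∈ B.isotropySubalgebra m) {f : C^∞⟮𝓘(ℝ, EM), M; ℝ⟯} (hf : f m = 0)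
    (k : B.kernelAlgebra) : ⁅a, f • k⁆ ∈ B.kernelVanishingAt m := by
  rw [IsLeibnizModule.lie_smul_right]
  exact Submodule.add_mem _ (smul_mem_kernelVanishingAt hf _)
    (smul_mem_kernelVanishingAt
      (SmoothVectorField.lie_function_apply_eq_zero (B.mem_isotropySubalgebra.1 ha) f) k)

variable [LieGroup 𝓘(ℝ, EG) ∞ G]

section AmbientNormalizer

variable [T2Space M] [SecondCountableTopology M] (hM : 0 < Module.finrank ℝ EM) {m : M}
  {J : LieIdeal ℝ B.kernelAlgebra}
  (hJ : J ∈ B.normalizedMaximalIdeals (B.isotropySubalgebra m))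
include hM hJ

theorem isAlgebraic_quotient_multiplierIdeal_of_mem :
    Algebra.IsAlgebraic ℝ
      (C^∞⟮𝓘(ℝ, EM), M; ℝ⟯ ⧸ multiplierIdeal C^∞⟮𝓘(ℝ, EM), M; ℝ⟯ J.toSubmodule) := by
  obtain ⟨a, h, hunit⟩ := B.exists_isUnit_sum_sq_lie hM
  exact isAlgebraic_quotient_multiplierIdeal_of_isLieRinehartModule hJ.1.2.1
    (B.cofg_isotropySubalgebra m) (fun _ hx => mem_ambientNormalizer_iff.1 (hJ.2 hx)) a h hunit

theorem ambientNormalizer_le_isotropySubalgebra {x : M}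
    (hx : ∀ f ∈ multiplierIdeal C^∞⟮𝓘(ℝ, EM), M; ℝ⟯ J.toSubmodule, f x = 0) :
    B.kernelAlgebra.ambientNormalizer J ≤ B.isotropySubalgebra x := by
  have := B.isAlgebraic_quotient_multiplierIdeal_of_mem hM hJ
  exact fun a ha => B.mem_isotropySubalgebra_of_forall_lie_mem hx fun f hf =>
    lie_mem_multiplierIdeal (mem_ambientNormalizer_iff.1 ha) hf

theorem eq_of_forall_mem_multiplierIdeal {x : M}
    (hx : ∀ f ∈ multiplierIdeal C^∞⟮𝓘(ℝ, EM), M; ℝ⟯ J.toSubmodule, f x = 0) : x = m :=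
  B.eq_of_isotropySubalgebra_le hM
    (hJ.2.trans (B.ambientNormalizer_le_isotropySubalgebra hM hJ hx))

theorem ambientNormalizer_eq :
    B.kernelAlgebra.ambientNormalizer J = B.isotropySubalgebra m := by
  have : LocallyCompactSpace M := ChartedSpace.locallyCompactSpace EM M
  have := B.isAlgebraic_quotient_multiplierIdeal_of_mem hM hJ
  obtain ⟨x, hx⟩ := exists_forall_mem_eq_zero (multiplierIdeal_ne_top
    (R := C^∞⟮𝓘(ℝ, EM), M; ℝ⟯) (LieSubmodule.toSubmodule_injective.ne hJ.1.1))
  obtain rfl : x = m := B.eq_of_forall_mem_multiplierIdeal hM hJ hx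
  exact le_antisymm (B.ambientNormalizer_le_isotropySubalgebra hM hJ hx) hJ.2

end AmbientNormalizer

variable [FiniteDimensional ℝ EG]

theorem kernelVanishingAt_le_of_forall_smul_mem [T2Space M] {m : M}
    {N : Submodule ℝ B.kernelAlgebra}
    (hN : ∀ f : C^∞⟮𝓘(ℝ, EM), M; ℝ⟯, f m = 0 → ∀ k : B.kernelAlgebra, f • k ∈ N) :
    B.kernelVanishingAt m ≤ N := by
  intro k hk
  obtain ⟨S, χ, hm, hχ, hχm⟩ := B.exists_cutoff m
  obtain ⟨c, hc, hczero⟩ := S.exists_sq_smul_eq_sum hχ (Module.finBasis ℝ EG) k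
  have hvertical : χ ^ 2 • k ∈ N := by
    rw [hc]
    exact N.sum_mem fun i _ => hN _ (hczero m hm hk i) _
  have hremainder : (1 - χ ^ 2) • k ∈ N := by
    refine hN _ ?_ k
    rw [← evalSmooth_apply, map_sub, map_one, map_pow, evalSmooth_apply, hχm, one_pow, sub_self]
  have hsum := N.add_mem hvertical hremainder
  rwa [← add_smul, add_sub_cancel, one_smul] at hsum

theorem lie_mem_kernelVanishingAt_of_mem_isotropySubalgebra [T2Space M] {m : M}
    {a : B.atiyahAlgebra} (ha : a ∈ B.isotropySubalgebra m) {k : B.kernelAlgebra}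
    (hk : k ∈ B.kernelVanishingAt m) : ⁅a, k⁆ ∈ B.kernelVanishingAt m :=
  B.kernelVanishingAt_le_of_forall_smul_mem
    (N := (B.kernelVanishingAt m).comap (LieModule.toEnd ℝ B.atiyahAlgebra B.kernelAlgebra a))
    (fun _ hf => B.lie_smul_mem_kernelVanishingAt ha hf) hk

section IsSemisimple

variable [LieAlgebra.IsSemisimple ℝ (GroupLieAlgebra 𝓘(ℝ, EG) G)]

/-- As `I = [I, I]`, the lift can be taken among sums of brackets of lifts of elements of `I`,
which derivations of `𝒦` preserve modulo the kernel of the evaluation. -/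
theorem exists_evalHom_eq_and_lie_mem {S : B.LocalSection} {m : M} (hm : m ∈ S.base)
    (hev : Function.Surjective (S.evalHom hm)) {I : LieIdeal ℝ (GroupLieAlgebra 𝓘(ℝ, EG) G)}
    (a : B.atiyahAlgebra) {ξ : GroupLieAlgebra 𝓘(ℝ, EG) G} (hξ : ξ ∈ I) :
    ∃ l, S.evalHom hm l = ξ ∧ S.evalHom hm ⁅a, l⁆ ∈ I := by
  rw [← lie_self_eq_of_isSemisimple I, ← LieSubmodule.mem_toSubmodule,
    LieSubmodule.lieIdeal_oper_eq_linear_span'] at hξ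
  induction hξ using Submodule.span_induction with
  | mem ξ hbracket =>
    obtain ⟨η, hη, ζ, hζ, rfl⟩ := hbracket
    obtain ⟨p, rfl⟩ := hev η
    obtain ⟨q, rfl⟩ := hev ζ
    have hleibniz : ⁅a, ⁅p, q⁆⁆ = ⁅⁅a, p⁆, q⁆ + ⁅p, ⁅a, q⁆⁆ :=
      Subtype.ext (leibniz_lie a p.1 q.1)
    refine ⟨⁅p, q⁆, LieHom.map_lie _ _ _, ?_⟩
    rw [hleibniz, map_add, LieHom.map_lie, LieHom.map_lie]
    exact I.add_mem (lie_mem_right ℝ _ I _ _ hζ) (lie_mem_left ℝ _ I _ _ hη)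
  | zero => exact ⟨0, map_zero _, by simp only [lie_zero, map_zero, I.zero_mem]⟩
  | add ξ η _ _ hξ hη =>
    obtain ⟨p, rfl, hp⟩ := hξ
    obtain ⟨q, rfl, hq⟩ := hη
    refine ⟨p + q, map_add _ _ _, ?_⟩
    rw [lie_add, map_add]
    exact I.add_mem hp hq
  | smul c ξ _ hξ =>
    obtain ⟨p, rfl, hp⟩ := hξ
    refine ⟨c • p, map_smul _ _ _, ?_⟩
    rw [lie_smul, map_smul]
    exact I.smul_mem c hp

variable [T2Space M]

theorem isotropySubalgebra_le_ambientNormalizer_comap {S : B.LocalSection} {m : M}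
    (hm : m ∈ S.base) (hev : Function.Surjective (S.evalHom hm))
    (I : LieIdeal ℝ (GroupLieAlgebra 𝓘(ℝ, EG) G)) :
    B.isotropySubalgebra m ≤ B.kernelAlgebra.ambientNormalizer (I.comap (S.evalHom hm)) := by
  refine fun a ha => mem_ambientNormalizer_iff.2 fun k hk => LieIdeal.mem_comap.2 ?_
  obtain ⟨l, hl, hal⟩ := B.exists_evalHom_eq_and_lie_mem hm hev a (LieIdeal.mem_comap.1 hk)
  have hkl : k - l ∈ B.kernelVanishingAt m := by
    rw [← S.evalHom_eq_zero_iff hm, map_sub, hl, sub_self]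
  have hlie := (S.evalHom_eq_zero_iff hm _).2
    (B.lie_mem_kernelVanishingAt_of_mem_isotropySubalgebra ha hkl)
  rw [lie_sub, map_sub, sub_eq_zero] at hlie
  rwa [hlie]

theorem exists_mem_normalizedMaximalIdeals_notMem {m : M} {k : B.kernelAlgebra}
    (hk : k ∉ B.kernelVanishingAt m) :
    ∃ J ∈ B.normalizedMaximalIdeals (B.isotropySubalgebra m), k ∉ J := by
  obtain ⟨S, χ, hm, hχ, hχm⟩ := B.exists_cutoff m
  have hev : Function.Surjective (S.evalHom hm) := fun ξ =>
    ⟨S.vertical hχ ξ, by rw [S.evalHom_vertical, hχm, one_smul]⟩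
  have : FiniteDimensional ℝ (GroupLieAlgebra 𝓘(ℝ, EG) G) :=
    inferInstanceAs (FiniteDimensional ℝ EG)
  obtain ⟨I, hI, hkI⟩ :=
    exists_isCoatom_notMem_of_isSemisimple (mt (S.evalHom_eq_zero_iff hm k).1 hk)
  exact ⟨I.comap (S.evalHom hm), ⟨isMaximalFiniteCodim_comap hev hI,
    B.isotropySubalgebra_le_ambientNormalizer_comap hm hev I⟩, mt LieIdeal.mem_comap.1 hkI⟩

section IsMaximal

variable [SecondCountableTopology M] (hM : 0 < Module.finrank ℝ EM) {m : M}
  {J : LieIdeal ℝ B.kernelAlgebra}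
  (hJ : J ∈ B.normalizedMaximalIdeals (B.isotropySubalgebra m))
include hM hJ

theorem exists_lie_notMem : ∃ k l : B.kernelAlgebra, ⁅k, l⁆ ∉ J := by
  have : LocallyCompactSpace M := ChartedSpace.locallyCompactSpace EM M
  have := B.isAlgebraic_quotient_multiplierIdeal_of_mem hM hJ
  by_contra! habelian
  obtain ⟨S, χ, -, hχ, hχm⟩ := B.exists_cutoff m
  have hcube := S.cube_mem_multiplierIdeal hχ (J := J.toSubmodule) habelian
  have hcubem : (χ ^ 3) m ≠ 0 := by
    rw [← evalSmooth_apply, map_pow, evalSmooth_apply, hχm, one_pow]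
    exact one_ne_zero
  rw [← mul_one (χ ^ 3)] at hcube
  exact multiplierIdeal_ne_top (LieSubmodule.toSubmodule_injective.ne hJ.1.1)
    ((Ideal.eq_top_iff_one _).2 (mem_of_mul_mem_of_unique_zero
      (fun _ => B.eq_of_forall_mem_multiplierIdeal hM hJ) hcubem hcube))

theorem kernelVanishingAt_le : B.kernelVanishingAt m ≤ J.toSubmodule := by
  have : LocallyCompactSpace M := ChartedSpace.locallyCompactSpace EM M
  have := B.isAlgebraic_quotient_multiplierIdeal_of_mem hM hJ
  have hradical : (multiplierIdeal C^∞⟮𝓘(ℝ, EM), M; ℝ⟯ J.toSubmodule).IsRadical :=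
    isRadical_multiplierIdeal hJ.1 (B.exists_lie_notMem hM hJ)
  exact B.kernelVanishingAt_le_of_forall_smul_mem fun f hf => hradical
    (mem_radical_of_unique_zero (fun _ => B.eq_of_forall_mem_multiplierIdeal hM hJ) hf)

end IsMaximal

theorem sInf_normalizedMaximalIdeals_eq [SecondCountableTopology M] (hM : 0 < Module.finrank ℝ EM)
    (m : M) : (sInf (B.normalizedMaximalIdeals (B.isotropySubalgebra m))).toSubmodule
      = B.kernelVanishingAt m := by
  apply le_antisymm
  · intro k hk
    by_contra hkm
    obtain ⟨J, hJ, hkJ⟩ := B.exists_mem_normalizedMaximalIdeals_notMem hkm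
    exact hkJ (sInf_le hJ hk)
  · rw [LieSubmodule.sInf_toSubmodule]
    refine le_sInf ?_
    rintro _ ⟨J, hJ, rfl⟩
    exact B.kernelVanishingAt_le hM hJ

end IsSemisimple

end SmoothPrincipalBundle

end NormalizedIdeals

theorem mainTheorem8_general
    {EM EG EP : Type*}
    [NormedAddCommGroup EM] [NormedSpace ℝ EM] [FiniteDimensional ℝ EM]
    [NormedAddCommGroup EG] [NormedSpace ℝ EG] [FiniteDimensional ℝ EG]
    [NormedAddCommGroup EP] [NormedSpace ℝ EP] [FiniteDimensional ℝ EP]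
    {M G P : Type*}
    [TopologicalSpace M] [T2Space M] [SecondCountableTopology M]
    [ChartedSpace EM M] [IsManifold 𝓘(ℝ, EM) ∞ M]
    [TopologicalSpace G] [ChartedSpace EG G] [Group G] [LieGroup 𝓘(ℝ, EG) ∞ G]
    [TopologicalSpace P] [ChartedSpace EP P] [IsManifold 𝓘(ℝ, EP) ∞ P]
    (hM : 0 < Module.finrank ℝ EM)
    (hG : LieAlgebra.HasTrivialRadical ℝ (GroupLieAlgebra 𝓘(ℝ, EG) G))
    (B : SmoothPrincipalBundle EM EG EP M G P) :
    (∀ m : M, (B.isotropySubalgebra m).IsMaximalFiniteCodim) ∧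
    ∀ T : LieSubalgebra ℝ B.atiyahAlgebra, T.IsMaximalFiniteCodim →
      ∃ m : M, (∀ m' : M, T = B.isotropySubalgebra m' ↔ m' = m) ∧
        (sInf (B.normalizedMaximalIdeals T)).toSubmodule = B.kernelVanishingAt m ∧
        ∀ J ∈ B.normalizedMaximalIdeals T, B.kernelAlgebra.ambientNormalizer J = T := by
  have : FiniteDimensional ℝ (GroupLieAlgebra 𝓘(ℝ, EG) G) :=
    inferInstanceAs (FiniteDimensional ℝ EG)
  have : LieAlgebra.IsKilling ℝ (GroupLieAlgebra 𝓘(ℝ, EG) G) := inferInstance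
  refine ⟨B.isMaximalFiniteCodim_isotropySubalgebra hM, fun T hT => ?_⟩
  obtain ⟨m, rfl⟩ := B.exists_eq_isotropySubalgebra_of_isMaximalFiniteCodim hM hT
  have huniq (m' : M) : B.isotropySubalgebra m = B.isotropySubalgebra m' ↔ m' = m :=
    ⟨fun h => B.eq_of_isotropySubalgebra_le hM h.le, fun h => h ▸ rfl⟩
  exact ⟨m, huniq, B.sInf_normalizedMaximalIdeals_eq hM m, fun _ hJ => B.ambientNormalizer_eq hM hJ⟩

theorem mainTheorem8
    {EM EG EP : Type*}
    [NormedAddCommGroup EM] [NormedSpace ℝ EM] [FiniteDimensional ℝ EM]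
    [NormedAddCommGroup EG] [NormedSpace ℝ EG] [FiniteDimensional ℝ EG]
    [NormedAddCommGroup EP] [NormedSpace ℝ EP] [FiniteDimensional ℝ EP]
    {M G P : Type*}
    [TopologicalSpace M] [T2Space M] [SecondCountableTopology M]
    [ChartedSpace EM M] [IsManifold 𝓘(ℝ, EM) ∞ M]
    [TopologicalSpace G] [T2Space G] [SecondCountableTopology G]
    [ChartedSpace EG G] [Group G] [LieGroup 𝓘(ℝ, EG) ∞ G]
    [TopologicalSpace P] [T2Space P] [SecondCountableTopology P]
    [ChartedSpace EP P] [IsManifold 𝓘(ℝ, EP) ∞ P]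
    (hM : 0 < Module.finrank ℝ EM)
    (hG : LieAlgebra.HasTrivialRadical ℝ (GroupLieAlgebra 𝓘(ℝ, EG) G))
    (B : SmoothPrincipalBundle EM EG EP M G P) :
    (∀ m : M, (B.isotropySubalgebra m).IsMaximalFiniteCodim) ∧
    ∀ T : LieSubalgebra ℝ B.atiyahAlgebra, T.IsMaximalFiniteCodim →
      ∃ m : M, (∀ m' : M, T = B.isotropySubalgebra m' ↔ m' = m) ∧
        (sInf (B.normalizedMaximalIdeals T)).toSubmodule = B.kernelVanishingAt m ∧
        ∀ J ∈ B.normalizedMaximalIdeals T, B.kernelAlgebra.ambientNormalizer J = T :=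
  mainTheorem8_general hM hG B
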